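/- Let $(M,\Omega)$ be a connected smooth symplectic manifold of dimension $2n\ge 2$ and let $\nabla$ be a symplectic connection, i.e. a (smooth) torsion-free affine connection with $\nabla\Omega=0$. Indices are raised and lowered with $\Omega$: $X_i=X^p\Omega_{pi}$, $X^i=\Omega^{ip}X_p$, $\Omega^{ip}\Omega_{pj}=-\delta_j{}^i$. The curvature is $R(X,Y)Z=\nabla_X\nabla_YZ-\nabla_Y\nabla_XZ-\nabla_{[X,Y]}Z$, with components $R_{ijk}{}^{l}$; $R_{ijkl}=R_{ijk}{}^p\Omega_{pl}$; the Ricci tensor is $R_{ij}=R_{pij}{}^p$, the Ricci endomorphism is $R_i{}^j$ (so $R_{ij}=R_i{}^p\Omega_{pj}$), and the curvature one-form is $\rho_i=\nabla^pR_{ip}$. For a symmetric tensor $B_{ij}$ put $\mathcal K(B)_{ijkl}=\Omega_{i(k}B_{l)j}-\Omega_{j(k}B_{l)i}+\Omega_{ij}B_{kl}$. Assume that $\nabla$ is symplectically flat, that is, Weyl flat, $W_{ijkl}=R_{ijkl}-\tfrac1{n+1}\mathcal K(\mathrm{Ric})_{ijkl}=0$, and preferred, $\nabla_{(i}R_{jk)}=0$.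 Then the following are equivalent: (1) the curvature one-form $\rho_i$ vanishes; (2) the Ricci tensor is parallel; (3) $\nabla$ is locally symmetric, i.e. its curvature tensor is parallel. If these hold, there is a constant $r\in\mathbb R$ with $2nr=R_{pq}R^{pq}$ everywhere and $$R_j{}^pR_p{}^i=-r\,\delta_j{}^i .$$ Moreover: (i) If $r>0$, then $J_i{}^j=|r|^{-1/2}R_i{}^j$ is a complex structure (smooth, $J^2=-\mathrm{Id}$, with vanishing Nijenhuis tensor) and $g_{ij}=-|r|^{-1/2}R_{ij}$ is a pseudo-Riemannian metric with $g(J\cdot,\cdot)=\Omega$, so that $(g,J,\Omega)$ is a pseudo-Kähler structure; its Levi-Civita connection is $\nabla$, and it has constant holomorphic sectional curvature, i.e. $R_{ijkl}=2c\,\mathcal K(g)_{ijkl}$ for some constant $c$. (ii) If $r<0$, then $J_i{}^j=|r|^{-1/2}R_i{}^j$ is a paracomplex structure (smooth, $J^2=\mathrm{Id}$, with eigenspaces for $\pm1$ of equal dimension and vanishing Nijenhuis tensor) and $g_{ij}=|r|^{-1/2}R_{ij}$ is a pseudo-Riemannian metric with $g(J\cdot,\cdot)=\Omega$, so that $(g,J,\Omega)$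 is a para-Kähler structure; its Levi-Civita connection is $\nabla$, and it has constant paraholomorphic sectional curvature, i.e. $R_{ijkl}=2c\,\mathcal K(g)_{ijkl}$ for some constant $c$. (iii) If $r=0$, one of the following holds: (a) $R_{ij}$ is identically zero and $\nabla$ is a flat affine connection. (b) The Ricci endomorphism is parallel, infinitesimally symplectic, and two-step nilpotent (at every point it is nonzero with square zero); its kernel is the symplectic annihilator of its image; its image and kernel are smooth subbundles of $TM$ of constant rank which are totally geodesic ($\nabla_XY$ is a section whenever $X,Y$ are) and integrable (the Lie bracket of two sections is a section); and the connections $(X,Y)\mapsto\nabla_XY$ that $\nabla$ induces along these subbundles (on sections $X,Y$ of the subbundle) are flat. -/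

import Mathlib

open scoped Manifold ContDiff Topology

noncomputable section

namespace SymplecticConnection

section Basics

/-! Vector fields, tensor fields and connections on a manifold `M` modelled on `E`. -/

/-- (Not necessarily smooth) vector fields on `M`. -/
abbrev VField (E M : Type*) [NormedAddCommGroup E] [NormedSpace ℝ E]
    [TopologicalSpace M] [ChartedSpace E M] : Type _ :=
  (x : M) → TangentSpace 𝓘(ℝ, E) x

/-- Fields of bilinear forms on the tangent spaces, i.e. covariant two-tensors. -/
abbrev FormField (E M : Type*) [NormedAddCommGroup E] [NormedSpace ℝ E]
    [TopologicalSpace M] [ChartedSpace E M] : Type _ :=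
  (x : M) → LinearMap.BilinForm ℝ (TangentSpace 𝓘(ℝ, E) x)

/-- Fields of endomorphisms of the tangent spaces. -/
abbrev EndField (E M : Type*) [NormedAddCommGroup E] [NormedSpace ℝ E]
    [TopologicalSpace M] [ChartedSpace E M] : Type _ :=
  (x : M) → Module.End ℝ (TangentSpace 𝓘(ℝ, E) x)

/-- Fields of subspaces of the tangent spaces. -/
abbrev Distribution (E M : Type*) [NormedAddCommGroup E] [NormedSpace ℝ E]
    [TopologicalSpace M] [ChartedSpace E M] : Type _ :=
  (x : M) → Submodule ℝ (TangentSpace 𝓘(ℝ, E) x)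

/-- Affine connections on `M`; `cov Y x (X x)` is `(∇_X Y)(x)`. -/
abbrev Conn (E M : Type*) [NormedAddCommGroup E] [NormedSpace ℝ E]
    [TopologicalSpace M] [ChartedSpace E M] [IsManifold 𝓘(ℝ, E) ∞ M] : Type _ :=
  CovariantDerivative 𝓘(ℝ, E) E (fun x : M => TangentSpace 𝓘(ℝ, E) x)

variable {E : Type*} [NormedAddCommGroup E] [NormedSpace ℝ E] [FiniteDimensional ℝ E]
  {M : Type*} [TopologicalSpace M] [ChartedSpace E M] [IsManifold 𝓘(ℝ, E) ∞ M]

/-- Smooth vector fields. -/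
def SmoothV (X : VField E M) : Prop :=
  ContMDiff 𝓘(ℝ, E) (𝓘(ℝ, E).prod 𝓘(ℝ, E)) ∞
    (fun x => Bundle.TotalSpace.mk' E (E := fun y : M => TangentSpace 𝓘(ℝ, E) y) x (X x))

/-- A field of bilinear forms is smooth if its values on smooth vector fields are smooth. -/
def SmoothForm (T : FormField E M) : Prop :=
  ∀ X Y : VField E M, SmoothV X → SmoothV Y →
    ContMDiff 𝓘(ℝ, E) 𝓘(ℝ, ℝ) ∞ (fun x => T x (X x) (Y x))

/-- A field of endomorphisms is smooth if it maps smooth vector fields to smooth vector fields. -/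
def SmoothEnd (A : EndField E M) : Prop :=
  ∀ X : VField E M, SmoothV X → SmoothV (fun x => A x (X x))

/-- The derivative `X f` of a function `f` along a vector field `X`. -/
def lieD (X : VField E M) (f : M → ℝ) (x : M) : ℝ :=
  mvfderiv 𝓘(ℝ, E) f x (X x)

/-- The Lie bracket of vector fields. -/
abbrev bracket (X Y : VField E M) : VField E M :=
  VectorField.mlieBracket 𝓘(ℝ, E) X Y

/-- The vector field with constant coefficients, in the preferred chart at `x`, that extends the
tangent vector `v` at `x`; it is smooth near `x`. -/
abbrev ext (x : M) (v : TangentSpace 𝓘(ℝ, E) x) : VField E M :=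
  FiberBundle.extend E v

/-- A basis of the tangent space at `x`, used to write contractions of indices. -/
def frame (x : M) :
    Module.Basis (Fin (Module.finrank ℝ E)) ℝ (TangentSpace 𝓘(ℝ, E) x) :=
  Module.finBasis ℝ E

/-! ### Symplectic forms -/

/-- `Ω` is a symplectic form: smooth, alternating, nondegenerate, and closed, where `dΩ` is
expressed by its values on vector fields. -/
structure IsSymplecticForm (Ω : FormField E M) : Prop where
  smooth : SmoothForm Ω
  alt : ∀ x, (Ω x).IsAlt
  nondegenerate : ∀ x, (Ω x).Nondegenerate
  closed : ∀ X Y Z : VField E M, SmoothV X → SmoothV Y → SmoothV Z → ∀ x,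
    lieD X (fun y => Ω y (Y y) (Z y)) x - lieD Y (fun y => Ω y (X y) (Z y)) x
      + lieD Z (fun y => Ω y (X y) (Y y)) x
      - Ω x (bracket X Y x) (Z x) + Ω x (bracket X Z x) (Y x) - Ω x (bracket Y Z x) (X x) = 0

/-- The components `Ω^{ij}` of the bivector with `Ω^{ip} Ω_{pj} = -δ_j^i`. -/
def inv (Ω : FormField E M) (x : M) :
    Matrix (Fin (Module.finrank ℝ E)) (Fin (Module.finrank ℝ E)) ℝ :=
  -(Matrix.of fun i j => Ω x (frame x i) (frame x j))⁻¹

/-! ### Covariant derivatives of tensors, curvature -/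

/-- `(∇_u T)(v, w)` at `x`. By tensoriality the extensions of `v`, `w` are immaterial. -/
def nablaForm (cov : Conn E M) (T : FormField E M) (x : M)
    (u v w : TangentSpace 𝓘(ℝ, E) x) : ℝ :=
  mvfderiv 𝓘(ℝ, E) (fun y => T y (ext x v y) (ext x w y)) x u
    - T x (cov (ext x v) x u) w - T x v (cov (ext x w) x u)

/-- `∇T = 0`. -/
def IsParallelForm (cov : Conn E M) (T : FormField E M) : Prop :=
  ∀ (x : M) (u v w : TangentSpace 𝓘(ℝ, E) x), nablaForm cov T x u v w = 0

/-- `∇A = 0`, i.e. `∇_X (A Y) = A (∇_X Y)`. -/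
def IsParallelEnd (cov : Conn E M) (A : EndField E M) : Prop :=
  ∀ X Y : VField E M, SmoothV X → SmoothV Y → ∀ x,
    cov (fun y => A y (Y y)) x (X x) = A x (cov Y x (X x))

/-- The vector field `R(X, Y) Z = ∇_X ∇_Y Z - ∇_Y ∇_X Z - ∇_{[X, Y]} Z`. -/
def curvOp (cov : Conn E M) (X Y Z : VField E M) : VField E M := fun x =>
  cov (fun y => cov Z y (Y y)) x (X x) - cov (fun y => cov Z y (X y)) x (Y x)
    - cov Z x (bracket X Y x)

/-- The curvature tensor `R(u, v) w` at `x`. By tensoriality the extensions are immaterial. -/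
def curv (cov : Conn E M) (x : M) (u v w : TangentSpace 𝓘(ℝ, E) x) : TangentSpace 𝓘(ℝ, E) x :=
  curvOp cov (ext x u) (ext x v) (ext x w) x

/-- The covariant derivative `(∇_a R)(u, v) w` of the curvature tensor at `x`. -/
def nablaCurv (cov : Conn E M) (x : M) (a u v w : TangentSpace 𝓘(ℝ, E) x) :
    TangentSpace 𝓘(ℝ, E) x :=
  cov (curvOp cov (ext x u) (ext x v) (ext x w)) x a
    - curv cov x (cov (ext x u) x a) v w - curv cov x u (cov (ext x v) x a) w
    - curv cov x u v (cov (ext x w) x a)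

/-- Vanishing of the curvature tensor. -/
def IsFlat (cov : Conn E M) : Prop :=
  ∀ (x : M) (u v w : TangentSpace 𝓘(ℝ, E) x), curv cov x u v w = 0

/-- Local symmetry (for torsion-free connections): the curvature tensor is parallel. -/
def IsLocallySymmetric (cov : Conn E M) : Prop :=
  ∀ (x : M) (a u v w : TangentSpace 𝓘(ℝ, E) x), nablaCurv cov x a u v w = 0

/-- The Ricci tensor `R_{ij} = R_{pij}^p`, i.e. `Ric(v, w) = tr (u ↦ R(u, v) w)`. -/
def ricci (cov : Conn E M) : FormField E M := fun x =>
  Matrix.toBilin (frame x) (Matrix.of fun i j =>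
    ∑ p, (frame x).coord p (curv cov x (frame x p) (frame x i) (frame x j)))

/-- The Ricci endomorphism `R_i^j = Ω^{jp} R_{ip}`, characterized by
`Ω(R u, v) = Ric(u, v)`. -/
def ricciEnd (Ω : FormField E M) (cov : Conn E M) : EndField E M := fun x =>
  Matrix.toLin (frame x) (frame x) (Matrix.of fun j i =>
    ∑ p, inv Ω x j p * ricci cov x (frame x i) (frame x p))

/-- The curvature one-form `ρ_i = ∇^p R_{ip} = Ω^{pq} ∇_q R_{ip}`. -/
def curvatureOneForm (Ω : FormField E M) (cov : Conn E M) (x : M)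
    (u : TangentSpace 𝓘(ℝ, E) x) : ℝ :=
  ∑ p, ∑ q, inv Ω x p q * nablaForm cov (ricci cov) x (frame x q) u (frame x p)

/-- The function `R_{pq} R^{pq}`, where `R^{pq} = Ω^{pa} Ω^{qb} R_{ab}`. -/
def ricciSq (Ω : FormField E M) (cov : Conn E M) (x : M) : ℝ :=
  ∑ p, ∑ q, ∑ a, ∑ b, ricci cov x (frame x p) (frame x q) *
    (inv Ω x p a * inv Ω x q b * ricci cov x (frame x a) (frame x b))

/-- The tensor `Ω_{i(k} B_{l)j} - Ω_{j(k} B_{l)i} + Ω_{ij} B_{kl}` built from symmetric `B`;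
the arguments `u, v, w, z` fill the slots `i, j, k, l`. -/
def modelCurv (Ω B : FormField E M) (x : M) (u v w z : TangentSpace 𝓘(ℝ, E) x) : ℝ :=
  (Ω x u w * B x z v + Ω x u z * B x w v) / 2 - (Ω x v w * B x z u + Ω x v z * B x w u) / 2
    + Ω x u v * B x w z

/-- The symplectic Weyl tensor, on a manifold of dimension `2n`. -/
def weyl (n : ℕ) (Ω : FormField E M) (cov : Conn E M) (x : M)
    (u v w z : TangentSpace 𝓘(ℝ, E) x) : ℝ :=
  Ω x (curv cov x u v w) z - 1 / ((n : ℝ) + 1) * modelCurv Ω (ricci cov) x u v w z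

/-- Vanishing of the symplectic Weyl tensor. -/
def IsWeylFlat (n : ℕ) (Ω : FormField E M) (cov : Conn E M) : Prop :=
  ∀ (x : M) (u v w z : TangentSpace 𝓘(ℝ, E) x), weyl n Ω cov x u v w z = 0

/-- The complete symmetrization of `∇ Ric` vanishes. -/
def IsPreferred (cov : Conn E M) : Prop :=
  ∀ (x : M) (u v w : TangentSpace 𝓘(ℝ, E) x),
    nablaForm cov (ricci cov) x u v w + nablaForm cov (ricci cov) x v w u
      + nablaForm cov (ricci cov) x w u v + nablaForm cov (ricci cov) x u w v
      + nablaForm cov (ricci cov) x v u w + nablaForm cov (ricci cov) x w v u = 0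

/-- Symplectically flat: Weyl flat and preferred. -/
def IsSymplecticallyFlat (n : ℕ) (Ω : FormField E M) (cov : Conn E M) : Prop :=
  IsWeylFlat n Ω cov ∧ IsPreferred cov

/-- Smooth torsion-free connections that preserve a field of bilinear forms. -/
structure IsTorsionFreePreserving [CompleteSpace E] (T : FormField E M) (cov : Conn E M) :
    Prop where
  smooth : CovariantDerivative.ContMDiffCovariantDerivative cov ∞
  torsion_free : cov.torsion = 0
  parallel : IsParallelForm cov T

/-- Symplectic connections. -/
abbrev IsSymplecticConnection [CompleteSpace E] (Ω : FormField E M) (cov : Conn E M) : Prop :=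
  IsTorsionFreePreserving Ω cov

/-- `cov` is the Levi-Civita connection of the pseudo-Riemannian metric `g`. -/
abbrev IsLeviCivita [CompleteSpace E] (g : FormField E M) (cov : Conn E M) : Prop :=
  IsTorsionFreePreserving g cov

/-! ### Pseudo-Kähler and para-Kähler structures -/

/-- Pseudo-Riemannian metrics (of any signature). -/
structure IsPseudoRiemannianMetric (g : FormField E M) : Prop where
  smooth : SmoothForm g
  symm : ∀ x u v, g x u v = g x v u
  nondegenerate : ∀ x, (g x).Nondegenerate

/-- Integrability of an endomorphism field `J`: its Nijenhuis tensor vanishes. -/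
def IsIntegrableEnd (J : EndField E M) : Prop :=
  ∀ X Y : VField E M, SmoothV X → SmoothV Y → ∀ x,
    bracket (fun y => J y (X y)) (fun y => J y (Y y)) x
      - J x (bracket (fun y => J y (X y)) Y x) - J x (bracket X (fun y => J y (Y y)) x)
      + J x (J x (bracket X Y x)) = 0

/-- Complex structures: smooth integrable `J` with `J² = -1`. -/
structure IsComplexStructure (J : EndField E M) : Prop where
  smooth : SmoothEnd J
  sq : ∀ x u, J x (J x u) = -u
  integrable : IsIntegrableEnd J

/-- Paracomplex structures: smooth integrable `J` with `J² = 1` whose eigenspaces for `1` and `-1`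
have the same dimension. -/
structure IsParacomplexStructure (J : EndField E M) : Prop where
  smooth : SmoothEnd J
  sq : ∀ x u, J x (J x u) = u
  eigenrank : ∀ x, Module.finrank ℝ (Module.End.eigenspace (J x) 1)
    = Module.finrank ℝ (Module.End.eigenspace (J x) (-1))
  integrable : IsIntegrableEnd J

/-- Pseudo-Kähler structures `(g, J, Ω)`, with the convention `g(J u, v) = Ω(u, v)`. -/
structure IsPseudoKahler (g : FormField E M) (J : EndField E M) (Ω : FormField E M) : Prop where
  symplectic : IsSymplecticForm Ω
  complex : IsComplexStructure J
  metric : IsPseudoRiemannianMetric g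
  compatible : ∀ x u v, g x (J x u) v = Ω x u v

/-- Para-Kähler structures `(g, J, Ω)`, with the convention `g(J u, v) = Ω(u, v)`. -/
structure IsParaKahler (g : FormField E M) (J : EndField E M) (Ω : FormField E M) : Prop where
  symplectic : IsSymplecticForm Ω
  paracomplex : IsParacomplexStructure J
  metric : IsPseudoRiemannianMetric g
  compatible : ∀ x u v, g x (J x u) v = Ω x u v

/-- The pseudo- or para-Kähler structure given by `g` and `Ω`, with Levi-Civita connection `cov`,
has constant (para-)holomorphic sectional curvature `4c`. -/
def HasConstHolomorphicCurvature (g Ω : FormField E M) (cov : Conn E M) (c : ℝ) : Prop :=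
  ∀ (x : M) (u v w z : TangentSpace 𝓘(ℝ, E) x),
    Ω x (curv cov x u v w) z = 2 * c * modelCurv Ω g x u v w z

/-! ### Subbundles of the tangent bundle -/

/-- `D` is a smooth subbundle of the tangent bundle (of constant rank). -/
def IsSubbundle (D : Distribution E M) : Prop :=
  ∃ k : ℕ, ∀ x : M, ∃ s : Fin k → VField E M, (∀ i, SmoothV (s i)) ∧
    ∀ᶠ y in 𝓝 x, LinearIndependent ℝ (fun i => s i y) ∧
      Submodule.span ℝ (Set.range fun i => s i y) = D y

/-- Smooth sections of `D`. -/
def IsSection (D : Distribution E M) (X : VField E M) : Prop :=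
  SmoothV X ∧ ∀ x, X x ∈ D x

/-- `∇_X Y` is a section of `D` whenever `X` and `Y` are, so `∇` induces a connection along `D`. -/
def IsTotallyGeodesic (cov : Conn E M) (D : Distribution E M) : Prop :=
  ∀ X Y : VField E M, IsSection D X → IsSection D Y → ∀ x, cov Y x (X x) ∈ D x

/-- Integrability of `D` as a bundle: sections of `D` are closed under the Lie bracket. -/
def IsIntegrable (D : Distribution E M) : Prop :=
  ∀ X Y : VField E M, IsSection D X → IsSection D Y → ∀ x, bracket X Y x ∈ D x

/-- The connection that `∇` induces along (the leaves of) the totally geodesic integrable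
subbundle `D`, namely `(X, Y) ↦ ∇_X Y` on sections of `D`, has zero curvature. -/
def InducedFlat (cov : Conn E M) (D : Distribution E M) : Prop :=
  ∀ X Y Z : VField E M, IsSection D X → IsSection D Y → IsSection D Z →
    ∀ x, curvOp cov X Y Z x = 0

/-- `D` is a totally geodesic integrable subbundle on which the induced connection is flat. -/
structure IsFlatTotallyGeodesicSubbundle (cov : Conn E M) (D : Distribution E M) : Prop where
  subbundle : IsSubbundle D
  totallyGeodesic : IsTotallyGeodesic cov D
  integrable : IsIntegrable D
  flat : InducedFlat cov D

/-- `A` is infinitesimally symplectic. -/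
def IsInfSymplectic (Ω : FormField E M) (A : EndField E M) : Prop :=
  ∀ x u v, Ω x (A x u) v + Ω x u (A x v) = 0

/-- At every point `A` is nilpotent of order exactly two. -/
def IsTwoStepNilpotent (A : EndField E M) : Prop :=
  ∀ x, A x * A x = 0 ∧ A x ≠ 0

/-- The symplectic annihilator of a field of subspaces. -/
def annihilator (Ω : FormField E M) (D : Distribution E M) : Distribution E M := fun x =>
  (Ω x).orthogonal (D x)

end Basics

end SymplecticConnection

end

/-! Weyl flatness expresses the curvature through `Ω` and Ric alone, R = K(Ric)/(n+1), so every
claim becomes a statement about the Ricci endomorphism A. Since `Ω` is parallel, ∇R = K(∇Ric)/(n+1),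
and K is injective on symmetric forms because K(B)(u,v,u,u) = 2Ω(u,v)B(u,u); this gives (2) ⇔ (3)
(`omega_nablaCurv`, `locallySymmetric_iff`). For (1) ⇒ (2), the differential Bianchi identity
becomes a cyclic identity for K(∇Ric). Its contraction, once ρ = 0, makes ∇Ric totally symmetric,
and a preferred connection has no totally symmetric part (`nabla_eq_zero_of_bianchi`). This is the
only place where preferredness enters.

If Ric is parallel then so is A, hence A commutes with every R(u,v). Inserting the formula for R
shows that each vector is an eigenvector of A², so A² is a scalar at each point
(`exists_sq_eq_smul`). The scalar has zero derivative, hence is a constant -r (`exists_sq_eq`). For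
r ≠ 0 a multiple of A squares to -1 or 1. It is integrable because it is parallel for a torsion-free
connection, and the corresponding multiple of Ric is a parallel metric g with R proportional to
K(g).

If r = 0, the image of A lies in its kernel, and every term of the curvature formula vanishes on
three kernel vectors. It remains to see that a parallel A has constant rank and that its image and
kernel have smooth frames. Near a point, the matrix a of A is compared with a fixed matrix L such
that a + L is invertible. The expression a(a + L)⁻¹L satisfies a homogeneous linear equation along
straight segments in a chart, so it vanishes nearby if it vanishes at the centre
(`mul_inverse_mul_eq_zero_of_commutator`). Its vanishing presents image and kernel as images of the
fixed spaces ker L and im L under smooth invertible matrices (`range_eq_map_ker`,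
`ker_eq_map_range`). Constant rank also yields the dichotomy between A vanishing everywhere and
nowhere. -/

set_option linter.unusedSectionVars false

noncomputable section

namespace SymplecticConnection

section Calculus

variable {E : Type*} [NormedAddCommGroup E] [NormedSpace ℝ E] [FiniteDimensional ℝ E]
  {M : Type*} [TopologicalSpace M] [ChartedSpace E M] [IsManifold 𝓘(ℝ, E) ∞ M]

/-! ### Smooth vector fields -/

theorem SmoothV.add {X Y : VField E M} (hX : SmoothV X) (hY : SmoothV Y) :
    SmoothV (fun x => X x + Y x) :=
  ContMDiff.add_section hX hY

theorem SmoothV.sub {X Y : VField E M} (hX : SmoothV X) (hY : SmoothV Y) :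
    SmoothV (fun x => X x - Y x) :=
  ContMDiff.sub_section hX hY

theorem SmoothV.smul {f : M → ℝ} {X : VField E M} (hf : ContMDiff 𝓘(ℝ, E) 𝓘(ℝ, ℝ) ∞ f)
    (hX : SmoothV X) : SmoothV (fun x => f x • X x) :=
  ContMDiff.smul_section hf hX

theorem SmoothV.const_smul {X : VField E M} (a : ℝ) (hX : SmoothV X) :
    SmoothV (fun x => a • X x) :=
  ContMDiff.const_smul_section hX

theorem SmoothV.sum {ι : Type*} {s : Finset ι} {X : ι → VField E M}
    (hX : ∀ i ∈ s, SmoothV (X i)) : SmoothV (fun x => ∑ i ∈ s, X i x) :=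
  ContMDiff.sum_section hX

theorem smoothV_zero : SmoothV (fun _ => 0 : VField E M) := by
  have := Bundle.contMDiff_zeroSection (IB := 𝓘(ℝ, E)) (n := ∞) ℝ
    (E := fun x : M => TangentSpace 𝓘(ℝ, E) x) (F := E)
  exact this

theorem SmoothV.mdifferentiableAt {X : VField E M} (hX : SmoothV X) (x : M) :
    MDiffAt (T% X) x :=
  (hX x).mdifferentiableAt (by simp)

theorem SmoothV.cov [CompleteSpace E] {cov : Conn E M}
    (hcov : CovariantDerivative.ContMDiffCovariantDerivative cov ∞)
    {X Y : VField E M} (hX : SmoothV X) (hY : SmoothV Y) :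
    SmoothV (fun x => cov Y x (X x)) := by
  have h := hcov.contMDiff.contMDiff (σ := Y) (ContMDiff.contMDiffOn hY)
  rw [contMDiffOn_univ] at h
  intro x
  exact ContMDiffAt.clm_bundle_apply (h x) (hX x)

theorem isManifold_minSmoothness (k : ℕ) : IsManifold 𝓘(ℝ, E) (minSmoothness ℝ k) M := by
  rw [minSmoothness_of_isRCLikeNormedField]
  exact IsManifold.of_le (n := ∞) (by exact_mod_cast le_top)

theorem SmoothV.bracket [CompleteSpace E] {X Y : VField E M} (hX : SmoothV X) (hY : SmoothV Y) :
    SmoothV (bracket X Y) := by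
  have : IsManifold 𝓘(ℝ, E) (minSmoothness ℝ 2) M := isManifold_minSmoothness 2
  have : IsManifold 𝓘(ℝ, E) ((⊤ : ℕ∞) + 1) M := by
    exact ‹IsManifold 𝓘(ℝ, E) ∞ M›
  exact ContDiff.mlieBracket_vectorField (m := ⊤) (n := ⊤) hX hY
    (by rw [minSmoothness_of_isRCLikeNormedField]; exact le_rfl)

theorem contMDiffAt_ext (x : M) (v : TangentSpace 𝓘(ℝ, E) x) {y : M}
    (hy : y ∈ (chartAt E x).source) :
    ContMDiffAt 𝓘(ℝ, E) (𝓘(ℝ, E).prod 𝓘(ℝ, E)) ∞ (T% (ext x v)) y := by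
  set t := trivializationAt E (TangentSpace 𝓘(ℝ, E)) x with ht
  have hs : y ∈ t.baseSet := by simpa [ht] using hy
  rw [t.contMDiffAt_section_iff hs]
  refine (contMDiffAt_const (c := (t ⟨x, v⟩).2)).congr_of_eventuallyEq ?_
  filter_upwards [t.open_baseSet.mem_nhds hs] with z hz
  simp [FiberBundle.extend, ← ht, hz]

/-- A vector field smooth near a point agrees near that point with a smooth one. -/
theorem exists_smoothV_eventuallyEq [T2Space M] {X : VField E M} {x : M} {U : Set M}
    (hU : U ∈ 𝓝 x)
    (hX : ∀ y ∈ U, ContMDiffAt 𝓘(ℝ, E) (𝓘(ℝ, E).prod 𝓘(ℝ, E)) ∞ (T% X) y) :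
    ∃ Y : VField E M, SmoothV Y ∧ ∀ᶠ y in 𝓝 x, Y y = X y := by
  obtain ⟨f, -, hf⟩ := ((SmoothBumpFunction.nhds_basis_tsupport (I := 𝓘(ℝ, E)) x).mem_iff).1
    (interior_mem_nhds.2 hU)
  refine ⟨fun y => f y • X y, ?_, ?_⟩
  · exact ContMDiffOn.smul_section_of_tsupport (u := interior U) f.contMDiff.contMDiffOn
      isOpen_interior hf
      fun y hy => (hX y (interior_subset hy)).contMDiffWithinAt
  · filter_upwards [f.eventuallyEq_one] with y hy
    simp [hy]

/-- A function smooth near a point agrees near that point with a smooth one. -/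
theorem exists_smooth_eventuallyEq [T2Space M] {f : M → ℝ} {x : M} {U : Set M}
    (hU : U ∈ 𝓝 x) (hf : ∀ y ∈ U, ContMDiffAt 𝓘(ℝ, E) 𝓘(ℝ, ℝ) ∞ f y) :
    ∃ g : M → ℝ, ContMDiff 𝓘(ℝ, E) 𝓘(ℝ, ℝ) ∞ g ∧ ∀ᶠ y in 𝓝 x, g y = f y := by
  obtain ⟨b, -, hb⟩ := ((SmoothBumpFunction.nhds_basis_tsupport (I := 𝓘(ℝ, E)) x).mem_iff).1
    (interior_mem_nhds.2 hU)
  refine ⟨fun y => b y • f y, ?_, ?_⟩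
  · refine contMDiff_of_tsupport fun y hy => ?_
    exact b.contMDiff.contMDiffAt.smul (hf y (interior_subset (hb (tsupport_smul_subset_left _ _ hy))))
  · filter_upwards [b.eventuallyEq_one] with y hy
    simp [hy]

theorem exists_smoothV_eventuallyEq_ext [T2Space M] (x : M) (v : TangentSpace 𝓘(ℝ, E) x) :
    ∃ V : VField E M, SmoothV V ∧ ∀ᶠ y in 𝓝 x, V y = ext x v y :=
  exists_smoothV_eventuallyEq (chart_source_mem_nhds E x) fun _ hy => contMDiffAt_ext x v hy

/-! ### Covariant derivatives and brackets depend on germs -/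

theorem cov_congr (cov : Conn E M) {X Y : VField E M} {x : M} (hX : MDiffAt (T% X) x)
    (h : ∀ᶠ y in 𝓝 x, Y y = X y) : cov Y x = cov X x := by
  refine cov.isCovariantDerivativeOn.congr_of_eventuallyEq ?_ hX Filter.univ_mem h
  exact hX.congr_of_eventuallyEq (h.mono fun y hy => by simp [hy])

theorem bracket_congr {X Y X' Y' : VField E M} {x : M}
    (hX : ∀ᶠ y in 𝓝 x, X' y = X y) (hY : ∀ᶠ y in 𝓝 x, Y' y = Y y) :
    bracket X' Y' x = bracket X Y x :=
  Filter.EventuallyEq.mlieBracket_vectorField_eq hX hY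

theorem cov_add (cov : Conn E M) {X Y : VField E M} (hX : SmoothV X) (hY : SmoothV Y) (x : M) :
    cov (fun y => X y + Y y) x = cov X x + cov Y x :=
  cov.isCovariantDerivativeOn.add (hX.mdifferentiableAt x) (hY.mdifferentiableAt x)

theorem cov_smul (cov : Conn E M) {f : M → ℝ} {X : VField E M}
    (hf : ContMDiff 𝓘(ℝ, E) 𝓘(ℝ, ℝ) ∞ f) (hX : SmoothV X) (x : M)
    (u : TangentSpace 𝓘(ℝ, E) x) :
    cov (fun y => f y • X y) x u = f x • cov X x u + mvfderiv 𝓘(ℝ, E) f x u • X x := by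
  have := cov.isCovariantDerivativeOn.leibniz (hX.mdifferentiableAt x)
    ((hf x).mdifferentiableAt (by simp))
  exact congrArg (fun L => L u) this

theorem cov_const_smul (cov : Conn E M) (a : ℝ) {X : VField E M} (hX : SmoothV X) (x : M) :
    cov (fun y => a • X y) x = a • cov X x :=
  cov.isCovariantDerivativeOn.smul_const a (hX.mdifferentiableAt x)

theorem cov_sub (cov : Conn E M) {X Y : VField E M} (hX : SmoothV X) (hY : SmoothV Y) (x : M) :
    cov (fun y => X y - Y y) x = cov X x - cov Y x := by
  have h1 := cov_add cov hX (hY.const_smul (-1)) x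
  rw [cov_const_smul cov (-1) hY] at h1
  simpa [sub_eq_add_neg] using h1

theorem cov_zero (cov : Conn E M) (x : M) : cov (fun _ => 0) x = 0 :=
  cov.isCovariantDerivativeOn.zero

theorem bracket_eq [CompleteSpace E] {cov : Conn E M} (h : cov.torsion = 0) {X Y : VField E M}
    (hX : SmoothV X) (hY : SmoothV Y) (x : M) :
    bracket X Y x = cov Y x (X x) - cov X x (Y x) :=
  (cov.torsion_eq_zero_iff.1 h (hX.mdifferentiableAt x) (hY.mdifferentiableAt x)).symm

end Calculus

/-! ### Tensoriality: operations on smooth fields that depend only on values at a point. -/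

section Tensoriality

variable {E : Type*} [NormedAddCommGroup E] [NormedSpace ℝ E] [FiniteDimensional ℝ E]
  {M : Type*} [TopologicalSpace M] [ChartedSpace E M] [IsManifold 𝓘(ℝ, E) ∞ M]

/-- Near every point there is a frame of smooth vector fields, in which smooth vector fields have
smooth components. -/
theorem exists_smooth_frame [T2Space M] (x : M) :
    ∃ e : Fin (Module.finrank ℝ E) → VField E M, (∀ i, SmoothV (e i)) ∧
      (∀ᶠ y in 𝓝 x, ∃ b : Module.Basis (Fin (Module.finrank ℝ E)) ℝ (TangentSpace 𝓘(ℝ, E) y),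
        ∀ i, b i = e i y) ∧
      (∀ X : VField E M, SmoothV X → ∃ c : Fin (Module.finrank ℝ E) → M → ℝ,
        (∀ i, ContMDiff 𝓘(ℝ, E) 𝓘(ℝ, ℝ) ∞ (c i)) ∧
        (∀ᶠ y in 𝓝 x, X y = ∑ i, c i y • e i y) ∧ (X x = 0 → ∀ i, c i x = 0)) ∧
      ∀ i, ∀ᶠ y in 𝓝 x, e i y = (trivializationAt E (TangentSpace 𝓘(ℝ, E)) x).symmL ℝ y
        (Module.finBasis ℝ E i) := by
  set t := trivializationAt E (TangentSpace 𝓘(ℝ, E)) x with ht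
  let b := Module.finBasis ℝ E
  have hx : x ∈ t.baseSet := FiberBundle.mem_baseSet_trivializationAt' x
  have hbase : t.baseSet ∈ 𝓝 x := t.open_baseSet.mem_nhds hx
  have h1 : ∀ i, ∃ Y : VField E M, SmoothV Y ∧ ∀ᶠ y in 𝓝 x, Y y = t.localFrame b i y := fun i =>
    exists_smoothV_eventuallyEq hbase fun y hy => contMDiffAt_localFrame_of_mem ∞ t b i hy
  choose e he he' using h1
  refine ⟨e, he, ?_, fun X hX => ?_, fun i => ?_⟩
  rotate_left 2
  · filter_upwards [hbase, he' i] with y hy h2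
    rw [h2, t.localFrame_apply_of_mem_baseSet b hy, Bundle.Trivialization.basisAt, Module.Basis.map_apply]
    simpa [ht, b] using (Bundle.Trivialization.symmL_apply (R := ℝ) _ hy _).symm
  · filter_upwards [hbase, Filter.eventually_all.2 he'] with y hy h2
    exact ⟨t.basisAt b hy, fun i => by rw [h2, t.localFrame_apply_of_mem_baseSet b hy]⟩
  have h2 : ∀ i, ∃ g : M → ℝ, ContMDiff 𝓘(ℝ, E) 𝓘(ℝ, ℝ) ∞ g ∧
      ∀ᶠ y in 𝓝 x, g y = t.localFrameCoeff 𝓘(ℝ, E) b i y (X y) := fun i =>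
    exists_smooth_eventuallyEq hbase fun y hy => contMDiffAt_localFrameCoeff b hy (hX y) i
  choose c hc hc' using h2
  refine ⟨c, hc, ?_, fun h0 i => ?_⟩
  · filter_upwards [t.eventually_eq_localFrame_sum_coeff_smul (I := 𝓘(ℝ, E)) (s := X) b hx,
      Filter.eventually_all.2 he', Filter.eventually_all.2 hc'] with y h1 h2 h3
    rw [h1]
    exact Finset.sum_congr rfl fun i _ => by rw [h2, h3]
  · rw [(hc' i).self_of_nhds, h0, map_zero]

/-- Operations on smooth vector fields that are linear over smooth functions. -/
structure SmoothTensorialAt {V : Type*} [AddCommGroup V] [Module ℝ V] (Φ : VField E M → V)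
    (x : M) : Prop where
  add : ∀ {X Y : VField E M}, SmoothV X → SmoothV Y → Φ (fun y => X y + Y y) = Φ X + Φ Y
  smul : ∀ {f : M → ℝ} {X : VField E M}, ContMDiff 𝓘(ℝ, E) 𝓘(ℝ, ℝ) ∞ f → SmoothV X →
    Φ (fun y => f y • X y) = f x • Φ X

namespace SmoothTensorialAt

variable {V : Type*} [AddCommGroup V] [Module ℝ V] {Φ : VField E M → V} {x : M}

/-- A bump function equal to 1 at `x` and supported where the fields agree makes the two products
equal; linearity over functions then strips it off. -/
theorem congr_germ [T2Space M] (h : SmoothTensorialAt Φ x) {X Y : VField E M} (hX : SmoothV X)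
    (hY : SmoothV Y) (hXY : ∀ᶠ y in 𝓝 x, X y = Y y) : Φ X = Φ Y := by
  obtain ⟨f, -, hf⟩ := ((SmoothBumpFunction.nhds_basis_tsupport (I := 𝓘(ℝ, E)) x).mem_iff).1 hXY
  have h1 : (fun y => f y • X y) = fun y => f y • Y y := by
    funext y
    by_cases hy : y ∈ tsupport f
    · rw [show X y = Y y from hf hy]
    · simp [image_eq_zero_of_notMem_tsupport hy]
  have h2 := h.smul f.contMDiff hX
  rw [h1, h.smul f.contMDiff hY, f.eq_one, one_smul, one_smul] at h2
  exact h2.symm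

theorem zero (h : SmoothTensorialAt Φ x) : Φ (fun _ => 0) = 0 := by
  have := h.smul (f := fun _ => 0) contMDiff_const smoothV_zero
  simpa using this

theorem sum (h : SmoothTensorialAt Φ x) {ι : Type*} {s : Finset ι} {X : ι → VField E M}
    (hX : ∀ i ∈ s, SmoothV (X i)) : Φ (fun y => ∑ i ∈ s, X i y) = ∑ i ∈ s, Φ (X i) := by
  classical
  induction s using Finset.induction_on with
  | empty => simpa using h.zero
  | insert a s ha ih =>
    have hs : ∀ i ∈ s, SmoothV (X i) := fun i hi => hX i (Finset.mem_insert_of_mem hi)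
    simp only [Finset.sum_insert ha]
    rw [← ih hs]
    exact h.add (hX a (Finset.mem_insert_self a s)) (SmoothV.sum hs)

theorem sub (h : SmoothTensorialAt Φ x) {X Y : VField E M} (hX : SmoothV X) (hY : SmoothV Y) :
    Φ (fun y => X y - Y y) = Φ X - Φ Y := by
  have h1 := h.add hX (hY.const_smul (-1))
  have h2 := h.smul (f := fun _ => -1) contMDiff_const hY
  rw [h2] at h1
  simpa [sub_eq_add_neg] using h1

theorem eq_zero [T2Space M] (h : SmoothTensorialAt Φ x) {X : VField E M} (hX : SmoothV X)
    (h0 : X x = 0) : Φ X = 0 := by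
  obtain ⟨e, he, -, H, -⟩ := exists_smooth_frame (E := E) x
  obtain ⟨c, hc, hXc, hc0⟩ := H X hX
  have hs : ∀ i ∈ Finset.univ, SmoothV (fun y => c i y • e i y) := fun i _ => (he i).smul (hc i)
  rw [h.congr_germ hX (SmoothV.sum hs) hXc, h.sum hs]
  exact Finset.sum_eq_zero fun i _ => by rw [h.smul (hc i) (he i), hc0 h0, zero_smul]

theorem pointwise [T2Space M] (h : SmoothTensorialAt Φ x) {X Y : VField E M} (hX : SmoothV X)
    (hY : SmoothV Y) (hXY : X x = Y x) : Φ X = Φ Y := by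
  rw [← sub_eq_zero, ← h.sub hX hY]
  exact h.eq_zero (hX.sub hY) (by simp [hXY])

end SmoothTensorialAt

/-! ### Tensoriality of the curvature -/

section Curvature

variable [CompleteSpace E] {cov : Conn E M}

theorem smoothV_curvOp (hcov : CovariantDerivative.ContMDiffCovariantDerivative cov ∞)
    {X Y Z : VField E M} (hX : SmoothV X) (hY : SmoothV Y) (hZ : SmoothV Z) :
    SmoothV (curvOp cov X Y Z) :=
  ((hX.cov hcov (hY.cov hcov hZ)).sub (hY.cov hcov (hX.cov hcov hZ))).sub
    ((hX.bracket hY).cov hcov hZ)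

theorem curvOp_swap (X Y Z : VField E M) (x : M) : curvOp cov X Y Z x = -curvOp cov Y X Z x := by
  simp only [curvOp, bracket]
  rw [VectorField.mlieBracket_swap_apply, map_neg]
  abel

theorem bracket_add_left {X X' Y : VField E M} (hX : SmoothV X) (hX' : SmoothV X') (x : M) :
    bracket (fun y => X y + X' y) Y x = bracket X Y x + bracket X' Y x :=
  VectorField.mlieBracket_add_left (hX.mdifferentiableAt x) (hX'.mdifferentiableAt x)

theorem bracket_smul_left {f : M → ℝ} {X Y : VField E M}
    (hf : ContMDiff 𝓘(ℝ, E) 𝓘(ℝ, ℝ) ∞ f) (hX : SmoothV X) (x : M) :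
    bracket (fun y => f y • X y) Y x
      = f x • bracket X Y x - mvfderiv 𝓘(ℝ, E) f x (Y x) • X x := by
  have := VectorField.mlieBracket_smul_left (I := 𝓘(ℝ, E)) (W := Y)
    ((hf x).mdifferentiableAt (by simp)) (hX.mdifferentiableAt x)
  exact this.trans (by module)

theorem tensorial_curvOp_left (hcov : CovariantDerivative.ContMDiffCovariantDerivative cov ∞)
    {Y Z : VField E M} (hZ : SmoothV Z) (x : M) :
    SmoothTensorialAt (fun X => curvOp cov X Y Z x) x where
  add {X X'} hX hX' := by
    simp only [curvOp, map_add, bracket_add_left hX hX']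
    rw [cov_add cov (hX.cov hcov hZ) (hX'.cov hcov hZ)]
    simp only [add_apply]
    abel
  smul {f X} hf hX := by
    simp only [curvOp, map_smul, map_sub, bracket_smul_left hf hX]
    rw [cov_smul cov hf (hX.cov hcov hZ)]
    module

theorem tensorial_curvOp_middle (hcov : CovariantDerivative.ContMDiffCovariantDerivative cov ∞)
    {X Z : VField E M} (hZ : SmoothV Z) (x : M) :
    SmoothTensorialAt (fun Y => curvOp cov X Y Z x) x where
  add hY hY' := by
    simp only [curvOp_swap X]
    rw [(tensorial_curvOp_left hcov hZ x).add hY hY']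
    abel
  smul {f Y} hf hY := by
    simp only [curvOp_swap X]
    rw [(tensorial_curvOp_left hcov hZ x).smul hf hY]
    module

theorem smooth_lieD {X : VField E M} {f : M → ℝ} (hX : SmoothV X)
    (hf : ContMDiff 𝓘(ℝ, E) 𝓘(ℝ, ℝ) ∞ f) : ContMDiff 𝓘(ℝ, E) 𝓘(ℝ, ℝ) ∞ (lieD X f) := by
  have h1 : ContMDiff (𝓘(ℝ, E).prod 𝓘(ℝ, E)) (𝓘(ℝ, ℝ).prod 𝓘(ℝ, ℝ)) ∞
      (tangentMap 𝓘(ℝ, E) 𝓘(ℝ, ℝ) f) := hf.contMDiff_tangentMap le_rfl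
  exact ((contMDiff_snd_tangentBundle_modelSpace ℝ 𝓘(ℝ, ℝ)).comp h1).comp hX

theorem bracket_smul_right {f : M → ℝ} {X Y : VField E M}
    (hf : ContMDiff 𝓘(ℝ, E) 𝓘(ℝ, ℝ) ∞ f) (hY : SmoothV Y) (x : M) :
    bracket X (fun y => f y • Y y) x = f x • bracket X Y x + lieD X f x • Y x := by
  have := VectorField.mlieBracket_smul_right (I := 𝓘(ℝ, E)) (V := X)
    ((hf x).mdifferentiableAt (by simp)) (hY.mdifferentiableAt x)
  exact this.trans (by simp only [lieD]; module)

theorem bracket_add_right {X Y Y' : VField E M} (hY : SmoothV Y) (hY' : SmoothV Y') (x : M) :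
    bracket X (fun y => Y y + Y' y) x = bracket X Y x + bracket X Y' x :=
  VectorField.mlieBracket_add_right (hY.mdifferentiableAt x) (hY'.mdifferentiableAt x)

theorem bracket_jacobi {X Y Z : VField E M} (hX : SmoothV X) (hY : SmoothV Y) (hZ : SmoothV Z)
    (x : M) : bracket X (bracket Y Z) x
      = bracket (bracket X Y) Z x + bracket Y (bracket X Z) x := by
  have : IsManifold 𝓘(ℝ, E) (minSmoothness ℝ 3) M := isManifold_minSmoothness 3
  have h2 : minSmoothness ℝ 2 ≤ ∞ := by
    rw [minSmoothness_of_isRCLikeNormedField]; exact ENat.LEInfty.out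
  exact VectorField.leibniz_identity_mlieBracket_apply ((hX x).of_le h2) ((hY x).of_le h2)
    ((hZ x).of_le h2)

/-- Derived from the Jacobi identity for `X`, `Y` and `f • Z` with `Z x ≠ 0`: after expanding by the
Leibniz rule and subtracting the Jacobi identity for `Z` itself, the coefficient of `Z x` is the
claim. -/
theorem lieD_bracket [T2Space M] {X Y : VField E M} {f : M → ℝ} (hX : SmoothV X) (hY : SmoothV Y)
    (hf : ContMDiff 𝓘(ℝ, E) 𝓘(ℝ, ℝ) ∞ f) (x : M) :
    lieD (bracket X Y) f x = lieD X (lieD Y f) x - lieD Y (lieD X f) x := by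
  by_cases hE : ∀ v : TangentSpace 𝓘(ℝ, E) x, v = 0
  -- In a zero tangent space no test field `Z` exists, but all derivatives vanish.
  · simp [lieD, hE (bracket X Y x), hE (X x), hE (Y x)]
  push Not at hE
  obtain ⟨v, hv⟩ := hE
  obtain ⟨Z, hZ, hZ'⟩ := exists_smoothV_eventuallyEq_ext x v
  have hZx : Z x = v := by simp [hZ'.self_of_nhds]
  have key : ∀ U W : VField E M, SmoothV U → SmoothV W →
      bracket U (bracket W (fun y => f y • Z y)) x
        = f x • bracket U (bracket W Z) x + lieD U f x • bracket W Z x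
          + lieD W f x • bracket U Z x + lieD U (lieD W f) x • Z x := fun U W hU hW => by
    have h1 : bracket W (fun y => f y • Z y) = fun y => f y • bracket W Z y + lieD W f y • Z y := by
      funext y; exact bracket_smul_right hf hZ y
    rw [h1, bracket_add_right ((hW.bracket hZ).smul hf) (hZ.smul (smooth_lieD hW hf)),
      bracket_smul_right hf (hW.bracket hZ), bracket_smul_right (smooth_lieD hW hf) hZ]
    abel
  have h1 := bracket_jacobi hX hY (hZ.smul hf) x
  rw [key X Y hX hY, key Y X hY hX, bracket_smul_right hf hZ, bracket_jacobi hX hY hZ, hZx] at h1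
  have h2 : (lieD (bracket X Y) f x - (lieD X (lieD Y f) x - lieD Y (lieD X f) x)) • v = 0 := by
    rw [← sub_eq_zero] at h1
    rw [← neg_eq_zero, ← h1]
    module
  exact sub_eq_zero.1 ((smul_eq_zero.1 h2).resolve_right hv)

/-- First derivatives of `f` cancel in pairs; the second derivatives cancel against the bracket term
by `lieD_bracket`. -/
theorem tensorial_curvOp_right [T2Space M]
    (hcov : CovariantDerivative.ContMDiffCovariantDerivative cov ∞)
    {X Y : VField E M} (hX : SmoothV X) (hY : SmoothV Y) (x : M) :
    SmoothTensorialAt (fun Z => curvOp cov X Y Z x) x where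
  add {Z Z'} hZ hZ' := by
    have h1 : ∀ W : VField E M, (fun y => cov (fun y => Z y + Z' y) y (W y))
        = fun y => cov Z y (W y) + cov Z' y (W y) := fun W => by
      funext y; rw [cov_add cov hZ hZ']; rfl
    simp only [curvOp, h1]
    rw [cov_add cov hZ hZ', cov_add cov (hY.cov hcov hZ) (hY.cov hcov hZ'),
      cov_add cov (hX.cov hcov hZ) (hX.cov hcov hZ')]
    simp only [add_apply]
    abel
  smul {f Z} hf hZ := by
    have h1 : ∀ W : VField E M, (fun y => cov (fun y => f y • Z y) y (W y))
        = fun y => f y • cov Z y (W y) + lieD W f y • Z y := fun W => by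
      funext y; rw [cov_smul cov hf hZ]; rfl
    have h2 : ∀ W U : VField E M, SmoothV W → 
        cov (fun y => f y • cov Z y (W y) + lieD W f y • Z y) x (U x)
         = f x • cov (fun y => cov Z y (W y)) x (U x) + lieD U f x • cov Z x (W x)
          + lieD W f x • cov Z x (U x) + lieD U (lieD W f) x • Z x := fun W U hW => by
      rw [cov_add cov ((hW.cov hcov hZ).smul hf) (hZ.smul (smooth_lieD hW hf)),
        add_apply, cov_smul cov hf (hW.cov hcov hZ),
        cov_smul cov (smooth_lieD hW hf) hZ]
      simp only [lieD]
      abel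
    have h3 := lieD_bracket hX hY hf x
    have h4 : mvfderiv 𝓘(ℝ, E) f x (bracket X Y x) = lieD (bracket X Y) f x := rfl
    simp only [curvOp, h1]
    rw [h2 Y X hY, h2 X Y hX, cov_smul cov hf hZ, h4, h3]
    module

theorem curvOp_congr_germ {X Y Z X' Y' Z' : VField E M} {x : M}
    (hcov : CovariantDerivative.ContMDiffCovariantDerivative cov ∞)
    (hX : SmoothV X) (hY : SmoothV Y) (hZ : SmoothV Z)
    (hX' : ∀ᶠ y in 𝓝 x, X' y = X y) (hY' : ∀ᶠ y in 𝓝 x, Y' y = Y y)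
    (hZ' : ∀ᶠ y in 𝓝 x, Z' y = Z y) : ∀ᶠ y in 𝓝 x, curvOp cov X' Y' Z' y = curvOp cov X Y Z y := by
  filter_upwards [hX'.eventually_nhds, hY'.eventually_nhds, hZ'.eventually_nhds] with y h1 h2 h3
  have h4 : ∀ᶠ z in 𝓝 y, cov Z' z = cov Z z :=
    h3.eventually_nhds.mono fun z hz => cov_congr cov (hZ.mdifferentiableAt z) hz
  simp only [curvOp]
  rw [bracket_congr h1 h2, h1.self_of_nhds, h2.self_of_nhds, h4.self_of_nhds,
    cov_congr cov ((hY.cov hcov hZ).mdifferentiableAt y) (Y := fun y => cov Z' y (Y' y))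
      ((h4.and h2).mono fun z hz => by rw [hz.1, hz.2]),
    cov_congr cov ((hX.cov hcov hZ).mdifferentiableAt y) (Y := fun y => cov Z' y (X' y))
      ((h4.and h1).mono fun z hz => by rw [hz.1, hz.2])]

/-- The extensions in `curv` are smooth only near `x`. They are first replaced by global smooth
fields with the same germs, and then tensoriality changes one argument at a time. -/
theorem curvOp_eq_curv [T2Space M]
    (hcov : CovariantDerivative.ContMDiffCovariantDerivative cov ∞)
    {X Y Z : VField E M} (hX : SmoothV X) (hY : SmoothV Y) (hZ : SmoothV Z) (x : M) :
    curvOp cov X Y Z x = curv cov x (X x) (Y x) (Z x) := by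
  obtain ⟨U, hU, hU'⟩ := exists_smoothV_eventuallyEq_ext x (X x)
  obtain ⟨V, hV, hV'⟩ := exists_smoothV_eventuallyEq_ext x (Y x)
  obtain ⟨W, hW, hW'⟩ := exists_smoothV_eventuallyEq_ext x (Z x)
  have hUx : X x = U x := by simp [hU'.self_of_nhds]
  have hVx : Y x = V x := by simp [hV'.self_of_nhds]
  have hWx : Z x = W x := by simp [hW'.self_of_nhds]
  have h1 : curv cov x (X x) (Y x) (Z x) = curvOp cov U V W x :=
    (curvOp_congr_germ hcov hU hV hW (hU'.mono fun y h => h.symm) (hV'.mono fun y h => h.symm)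
      (hW'.mono fun y h => h.symm)).self_of_nhds
  rw [h1, (tensorial_curvOp_left hcov hZ x).pointwise hX hU hUx,
    (tensorial_curvOp_middle hcov hZ x).pointwise hY hV hVx,
    (tensorial_curvOp_right hcov hU hV x).pointwise hZ hW hWx]

end Curvature

end Tensoriality

/-! ### Symplectic linear algebra -/

section Algebra

variable {V : Type*} [AddCommGroup V] [Module ℝ V] {Ω B : LinearMap.BilinForm ℝ V}

/-- The basis `f` is dual to the basis `e` with respect to `Ω`, up to sign: `f p = Ω^{pq} e q`. -/
structure IsSymplecticDual {ι : Type*} [DecidableEq ι] (Ω : LinearMap.BilinForm ℝ V)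
    (e : Module.Basis ι ℝ V) (f : ι → V) : Prop where
  alt : Ω.IsAlt
  dual : ∀ p q, Ω (f p) (e q) = if p = q then -1 else 0

namespace IsSymplecticDual

variable {ι : Type*} [Fintype ι] [DecidableEq ι] {e : Module.Basis ι ℝ V} {f : ι → V}

theorem skew (h : IsSymplecticDual Ω e f) (u v : V) : Ω u v = -Ω v u := by
  rw [LinearMap.BilinForm.IsAlt.neg_eq h.alt]

theorem coord_eq (h : IsSymplecticDual Ω e f) (p : ι) (v : V) : e.coord p v = -Ω (f p) v := by
  conv_rhs => rw [← e.sum_repr v]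
  rw [map_sum]
  simp [h.dual]

/-- With `sum_right`, this is the rule for contracting an index against `Ω`; the signs reflect the
convention Ω^{ip}Ω_{pj} = -δ. -/
theorem sum_left (h : IsSymplecticDual Ω e f) {W : Type*} [AddCommGroup W] [Module ℝ W]
    (φ : V →ₗ[ℝ] W) (v : V) : ∑ p, Ω (f p) v • φ (e p) = -φ v := by
  conv_rhs => rw [← e.sum_repr v]
  rw [map_sum, ← Finset.sum_neg_distrib]
  refine Finset.sum_congr rfl fun p _ => ?_
  rw [map_smul, ← neg_smul, ← e.coord_apply, h.coord_eq, neg_neg]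

/-- The bivector Ω^{pq} is skew, so moving the raised index from one slot of a contraction to the
other changes the sign. -/
theorem sum_swap (h : IsSymplecticDual Ω e f) {W : Type*} [AddCommGroup W] [Module ℝ W]
    (S : V →ₗ[ℝ] V →ₗ[ℝ] W) : ∑ p, S (f p) (e p) = -∑ p, S (e p) (f p) := by
  have h1 : ∀ p, ∑ q, Ω (f q) (f p) • S (e q) (e p) = -S (f p) (e p) := fun p =>
    h.sum_left (S.flip (e p)) (f p)
  have h2 : ∀ p, ∑ q, Ω (f q) (f p) • S (e p) (e q) = -S (e p) (f p) := fun p =>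
    h.sum_left (S (e p)) (f p)
  rw [← neg_inj, ← Finset.sum_neg_distrib, ← Finset.sum_neg_distrib]
  simp_rw [← h1, ← h2]
  rw [Finset.sum_comm, ← Finset.sum_neg_distrib]
  refine Finset.sum_congr rfl fun p _ => ?_
  rw [← Finset.sum_neg_distrib]
  refine Finset.sum_congr rfl fun q _ => ?_
  rw [h.skew (f p), neg_smul]

theorem sum_right (h : IsSymplecticDual Ω e f) {W : Type*} [AddCommGroup W] [Module ℝ W]
    (φ : V →ₗ[ℝ] W) (v : V) : ∑ p, Ω (e p) v • φ (f p) = φ v := by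
  have := h.sum_swap ((LinearMap.lsmul ℝ W).compl₁₂ (LinearMap.flip Ω v) φ)
  simp only [LinearMap.compl₁₂_apply, LinearMap.flip_apply, LinearMap.lsmul_apply] at this
  have h2 := h.sum_left φ v
  rw [h2] at this
  exact (neg_injective this).symm

theorem sum_pairing (h : IsSymplecticDual Ω e f) : ∑ p, Ω (e p) (f p) = Fintype.card ι := by
  simp [h.skew (e _), h.dual]

end IsSymplecticDual

/-- The tensor `Ω_{i(k} B_{l)j} - Ω_{j(k} B_{l)i} + Ω_{ij} B_{kl}` on a vector space. -/
def modelForm (Ω B : LinearMap.BilinForm ℝ V) (u v w z : V) : ℝ :=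
  (Ω u w * B z v + Ω u z * B w v) / 2 - (Ω v w * B z u + Ω v z * B w u) / 2 + Ω u v * B w z

variable {ι : Type*} [Fintype ι] [DecidableEq ι] {e : Module.Basis ι ℝ V} {f : ι → V} {n : ℕ}
  {R : V → V → V → V}

/-- Taking the Ricci trace of the curvature formula shows that the skew part of `B` is a multiple of
t·Ω, where t is the trace of `B` against Ω. Tracing this relation once more gives (n + 2)t = 0. -/
theorem ricci_symm_of_weyl_eq_zero (h : IsSymplecticDual Ω e f)
    (hn : Fintype.card ι = 2 * n)
    (hR : ∀ u v w z, Ω (R u v w) z = 1 / ((n : ℝ) + 1) * modelForm Ω B u v w z)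
    (hB : ∀ i j, B (e i) (e j) = ∑ p, e.coord p (R (e p) (e i) (e j))) (v w : V) : B v w = B w v := by
  have hn0 : (n : ℝ) + 1 ≠ 0 := by positivity
  set t := ∑ p, B (f p) (e p) with ht
  have hcard : (Fintype.card ι : ℝ) = 2 * n := by exact_mod_cast hn
  have key0 : ∀ i j, ((n : ℝ) + 1) * B (e i) (e j)
      = (n + 1) * B (e j) (e i) - t / 2 * Ω (e i) (e j) := fun i j => by
    obtain ⟨v, hv⟩ : ∃ v, v = e i := ⟨_, rfl⟩
    obtain ⟨w, hw⟩ : ∃ w, w = e j := ⟨_, rfl⟩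
    have h1 : ∀ p, ((n : ℝ) + 1) * e.coord p (R (e p) v w)
        = (Ω (e p) w • LinearMap.flip B v (f p) + Ω (e p) (f p) * B w v) / 2
          - (Ω v w * B (f p) (e p) - Ω (f p) v • B w (e p)) / 2 + Ω (e p) v • B w (f p) := fun p => by
      rw [h.coord_eq, h.skew, neg_neg, hR, modelForm, h.skew v (f p)]
      simp only [smul_eq_mul, LinearMap.flip_apply]
      field_simp
      ring
    rw [hB i j, ← hv, ← hw, Finset.mul_sum, Finset.sum_congr rfl fun p _ => h1 p, Finset.sum_add_distrib,
      Finset.sum_sub_distrib, ← Finset.sum_div, ← Finset.sum_div, Finset.sum_add_distrib,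
      Finset.sum_sub_distrib, h.sum_right, h.sum_right, h.sum_left, ← Finset.sum_mul,
      h.sum_pairing, ← Finset.mul_sum, hcard, LinearMap.flip_apply]
    ring
  have key : ∀ v w, ((n : ℝ) + 1) * B v w = (n + 1) * B w v - t / 2 * Ω v w := fun v w => by
    have : ((n : ℝ) + 1) • B = ((n : ℝ) + 1) • LinearMap.flip B - (t / 2) • Ω :=
      LinearMap.BilinForm.ext_basis e fun i j => key0 i j
    exact congrArg (fun L : LinearMap.BilinForm ℝ V => L v w) this
  have ht0 : t = 0 := by
    have h1 : ∑ p, B (e p) (f p) = -t := by rw [ht, h.sum_swap, neg_neg]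
    have h2 : ∑ p, ((n : ℝ) + 1) * B (e p) (f p)
        = ∑ p, ((n + 1) * B (f p) (e p) - t / 2 * Ω (e p) (f p)) :=
      Finset.sum_congr rfl fun p _ => key _ _
    rw [Finset.sum_sub_distrib, ← Finset.mul_sum, ← Finset.mul_sum, ← Finset.mul_sum, h1,
      h.sum_pairing, hcard, ← ht] at h2
    have h3 : t * ((n : ℝ) + 2) = 0 := by linear_combination -h2
    exact (mul_eq_zero.1 h3).resolve_right (by positivity)
  have := key v w
  rw [ht0] at this
  exact mul_left_cancel₀ hn0 (by linear_combination this)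

variable {A : Module.End ℝ V}

/-- The endomorphism form of the curvature of a Weyl flat connection. -/
theorem weylFlat_curv_eq (hnd : Ω.Nondegenerate) (hA : ∀ u v, Ω (A u) v = B u v)
    (hB : ∀ u v, B u v = B v u)
    (hR : ∀ u v w z, Ω (R u v w) z = 1 / ((n : ℝ) + 1) * modelForm Ω B u v w z) (u v w : V) :
    R u v w = (1 / (2 * ((n : ℝ) + 1))) •
      (Ω u w • A v + B v w • u - Ω v w • A u - B u w • v + (2 * Ω u v) • A w) := by
  have hn0 : (n : ℝ) + 1 ≠ 0 := by positivity
  rw [← sub_eq_zero]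
  refine hnd.1 _ fun z => ?_
  simp only [map_sub, map_add, map_smul, LinearMap.sub_apply, LinearMap.add_apply,
    LinearMap.smul_apply, smul_eq_mul, hR, hA, modelForm]
  rw [hB z v, hB z u, hB w v, hB w u]
  field_simp
  ring

/-- In R(u,v)Aw = A R(u,v)w the terms linear in A and the term in A²w cancel, which leaves an
identity relating A² to the form Ω(A·,A·). -/
theorem exists_sq_eq_smul (hΩ : Ω.IsAlt) (hnd : Ω.Nondegenerate)
    (hA : ∀ u v, Ω (A u) v = B u v) (hB : ∀ u v, B u v = B v u)
    (hR : ∀ u v w z, Ω (R u v w) z = 1 / ((n : ℝ) + 1) * modelForm Ω B u v w z)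
    (hcomm : ∀ u v w, R u v (A w) = A (R u v w)) : ∃ c : ℝ, ∀ v, A (A v) = c • v := by
  have hn0 : (n : ℝ) + 1 ≠ 0 := by positivity
  have hskew : ∀ u v, Ω u v = -Ω v u := fun u v => by
    rw [LinearMap.BilinForm.IsAlt.neg_eq hΩ]
  have hAs : ∀ u v, Ω u (A v) = -B u v := fun u v => by rw [hskew, hA, hB]
  have key : ∀ u v w, Ω (A v) (A w) • u - Ω (A u) (A w) • v
      = Ω u w • A (A v) - Ω v w • A (A u) := fun u v w => by
    have h1 := hcomm u v w
    simp only [weylFlat_curv_eq hnd hA hB hR, map_smul, map_add, map_sub] at h1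
    have h2 := smul_right_injective V (r := 1 / (2 * ((n : ℝ) + 1))) (by positivity) h1
    rw [hAs u w, hAs v w] at h2
    rw [hA v, hA u]
    rw [← sub_eq_zero] at h2 ⊢
    rw [← h2]
    module
  -- Putting w = v makes every vector an eigenvector of A².
  have h1 : ∀ u v, Ω u v • A (A v) = (-Ω (A u) (A v)) • v := fun u v => by
    have := key u v v
    rw [hΩ.self_eq_zero, hΩ.self_eq_zero] at this
    rw [zero_smul, zero_smul, zero_sub, sub_zero] at this
    rw [neg_smul, this]
  have h2 : ∀ v, ∃ c : ℝ, A (A v) = c • v := fun v => by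
    by_cases hv : v = 0
    · exact ⟨0, by simp [hv]⟩
    obtain ⟨u, hu⟩ : ∃ u, Ω u v ≠ 0 := by
      by_contra hcon
      push Not at hcon
      exact hv (hnd.2 v hcon)
    refine ⟨(Ω u v)⁻¹ * -Ω (A u) (A v), ?_⟩
    rw [mul_smul, ← h1, smul_smul, inv_mul_cancel₀ hu, one_smul]
  -- A linear map for which every vector is an eigenvector is a scalar.
  obtain ⟨c, hc⟩ := LinearMap.exists_eq_smul_id_of_forall_notLinearIndependent (f := A ∘ₗ A)
    fun v => by
      obtain ⟨c, hc⟩ := h2 v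
      rw [LinearIndependent.pair_iff]
      push Not
      exact ⟨c, -1, by simp [hc], by simp⟩
  exact ⟨c, fun v => congrArg (fun L : V →ₗ[ℝ] V => L v) hc⟩

/-- Contracting the index `q` turns the product into -Ω(A²e_p, f_p) = r Ω(e_p, f_p), and the
remaining trace of Ω is the dimension. -/
theorem ricciSq_eq (h : IsSymplecticDual Ω e f) (hn : Fintype.card ι = 2 * n)
    (hA : ∀ u v, Ω (A u) v = B u v) (hB : ∀ u v, B u v = B v u) {r : ℝ}
    (hr : ∀ v, A (A v) = -r • v) : ∑ p, ∑ q, B (e p) (e q) * B (f p) (f q) = 2 * n * r := by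
  have h1 : ∀ p, ∑ q, B (e p) (e q) * B (f p) (f q) = r * Ω (e p) (f p) := fun p => by
    have := h.sum_right (B (f p)) (A (e p))
    have h2 : ∀ q, B (e p) (e q) * B (f p) (f q) = -(Ω (e q) (A (e p)) • B (f p) (f q)) := fun q => by
      rw [h.skew, hA, smul_eq_mul]; ring
    rw [Finset.sum_congr rfl fun q _ => h2 q, Finset.sum_neg_distrib, this, hB, ← hA, hr]
    simp
  rw [Finset.sum_congr rfl fun p _ => h1 p, ← Finset.mul_sum, h.sum_pairing, hn]
  push_cast
  ring

/-- Contracting the Bianchi identity in the slots of `u` and `z` leaves only multiples of T(a,v,w) -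
T(v,a,w), apart from traces that vanish. So `T` is totally symmetric, and then `hcyc` says 3T = 0.
-/
theorem nabla_eq_zero_of_bianchi (h : IsSymplecticDual Ω e f) (hn : Fintype.card ι = 2 * n)
    {T : V →ₗ[ℝ] LinearMap.BilinForm ℝ V} (hT : ∀ a u v, T a u v = T a v u)
    (hcyc : ∀ a u v, T a u v + T u v a + T v a u = 0)
    (htr : ∀ u, ∑ p, T (f p) u (e p) = 0)
    (hbianchi : ∀ a u v w z, modelForm Ω (T a) u v w z + modelForm Ω (T u) v a w z
      + modelForm Ω (T v) a u w z = 0) : T = 0 := by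
  have hcard : (Fintype.card ι : ℝ) = 2 * n := by exact_mod_cast hn
  -- A symmetric form has zero trace against the skew Ω.
  have hs0 : ∀ a, ∑ p, T a (f p) (e p) = 0 := fun a => by
    have h1 := h.sum_swap (T a)
    have h2 : ∑ p, T a (e p) (f p) = ∑ p, T a (f p) (e p) :=
      Finset.sum_congr rfl fun p _ => hT _ _ _
    rw [h2] at h1
    linarith
  have key : ∀ a v w, T a v w = T v a w := fun a v w => by
    have h1 : ∀ p, modelForm Ω (T a) (f p) v w (e p) + modelForm Ω (T (f p)) v a w (e p)
      + modelForm Ω (T v) a (f p) w (e p) = 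
        (Ω (f p) w • (T a v - T v a) (e p)) / 2 
        + Ω v w / 2 * (T (f p) a (e p) - T a (f p) (e p))
        + Ω a w / 2 * (T v (f p) (e p) - T (f p) v (e p))
        - Ω (e p) (f p) * (T a v w - T v a w) / 2
        - (Ω (e p) v • ((T.flip a).flip w - LinearMap.flip (T a) w) (f p)) / 2
        - (Ω (e p) a • (LinearMap.flip (T v) w - (T.flip v).flip w) (f p)) / 2
        + Ω (f p) v • T a w (e p) + Ω v a * T (f p) w (e p) - Ω (f p) a • T v w (e p) := fun p => by
      simp only [modelForm, LinearMap.sub_apply, LinearMap.flip_apply, smul_eq_mul]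
      rw [h.skew (f p) (e p), h.skew v (e p), h.skew a (e p), h.skew a (f p)]
      rw [hT a (e p), hT a w v, hT (f p) (e p), hT (f p) (e p), hT (f p) w, hT v (e p), hT v (e p), hT v w a, hT a (e p), hT a (f p) w,
        hT v (f p) w, hT (f p) v w]
      ring
    have h2 : ∑ p, (modelForm Ω (T a) (f p) v w (e p) + modelForm Ω (T (f p)) v a w (e p)
      + modelForm Ω (T v) a (f p) w (e p)) = 0 :=
      Finset.sum_eq_zero fun p _ => hbianchi _ _ _ _ _
    rw [Finset.sum_congr rfl fun p _ => h1 p] at h2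
    simp only [Finset.sum_add_distrib, Finset.sum_sub_distrib, ← Finset.sum_div, ← Finset.mul_sum,
      ← Finset.sum_mul, h.sum_left, h.sum_right, htr, hs0, h.sum_pairing, hcard] at h2
    simp only [LinearMap.sub_apply, LinearMap.flip_apply] at h2
    rw [hT a w v, hT v w a] at h2
    -- The trace of Ω contributes n; the other surviving contractions add up to 1/2.
    have h3 : (T a v w - T v a w) * (n + 1 / 2) = 0 := by linear_combination -h2
    have := (mul_eq_zero.1 h3).resolve_right (by positivity)
    linarith
  ext a u v
  have h1 := hcyc a u v
  rw [key u v a, hT v u a, key v a u] at h1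
  simp only [LinearMap.zero_apply]
  linarith [hT a u v]

end Algebra

section Forms

variable {E : Type*} [NormedAddCommGroup E] [NormedSpace ℝ E] [FiniteDimensional ℝ E]
  {M : Type*} [TopologicalSpace M] [ChartedSpace E M] [IsManifold 𝓘(ℝ, E) ∞ M] [T2Space M]

/-! ### Covariant derivatives of bilinear forms -/

theorem exists_smoothV_apply_eq (x : M) (v : TangentSpace 𝓘(ℝ, E) x) :
    ∃ V : VField E M, SmoothV V ∧ V x = v := by
  obtain ⟨V, hV, h⟩ := exists_smoothV_eventuallyEq_ext x v
  exact ⟨V, hV, by simp [h.self_of_nhds]⟩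

theorem SmoothForm.mdifferentiableAt {T : FormField E M} (hT : SmoothForm T) {Y Z : VField E M}
    (hY : SmoothV Y) (hZ : SmoothV Z) (x : M) :
    MDifferentiableAt 𝓘(ℝ, E) 𝓘(ℝ, ℝ) (fun y => T y (Y y) (Z y)) x :=
  (hT Y Z hY hZ x).mdifferentiableAt (by simp)

theorem mvfderiv_congr {f g : M → ℝ} {x : M} (h : ∀ᶠ y in 𝓝 x, f y = g y) :
    mvfderiv 𝓘(ℝ, E) f x = mvfderiv 𝓘(ℝ, E) g x := by
  have h1 : mfderiv 𝓘(ℝ, E) 𝓘(ℝ, ℝ) f x = mfderiv 𝓘(ℝ, E) 𝓘(ℝ, ℝ) g x :=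
    Filter.EventuallyEq.mfderiv_eq h
  ext v
  exact congrArg (fun L : E →L[ℝ] ℝ => L v) h1

/-- The right side is linear over functions in `Y` and in `Z`, because the Leibniz terms of the
derivative cancel those of the connection. Hence it agrees with its value on the extensions used in
`nablaForm`. -/
theorem nablaForm_eq (cov : Conn E M) {T : FormField E M} (hT : SmoothForm T) {Y Z : VField E M}
    (hY : SmoothV Y) (hZ : SmoothV Z) (x : M) (u : TangentSpace 𝓘(ℝ, E) x) :
    nablaForm cov T x u (Y x) (Z x) = mvfderiv 𝓘(ℝ, E) (fun y => T y (Y y) (Z y)) x u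
      - T x (cov Y x u) (Z x) - T x (Y x) (cov Z x u) := by
  set Φ : VField E M → VField E M → ℝ := fun Y Z =>
    mvfderiv 𝓘(ℝ, E) (fun y => T y (Y y) (Z y)) x u
      - T x (cov Y x u) (Z x) - T x (Y x) (cov Z x u) with hΦ
  have h1 : ∀ {Z : VField E M}, SmoothV Z → SmoothTensorialAt (fun Y => Φ Y Z) x := fun {Z} hZ =>
    { add := fun {Y Y'} hY hY' => by
        simp only [hΦ, map_add, LinearMap.add_apply, cov_add cov hY hY', add_apply]
        rw [mvfderiv_fun_add (hT.mdifferentiableAt hY hZ x) (hT.mdifferentiableAt hY' hZ x),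
          add_apply]
        ring
      smul := fun {f Y} hf hY => by
        simp only [hΦ, map_smul, map_add, LinearMap.add_apply, LinearMap.smul_apply,
          cov_smul cov hf hY, smul_eq_mul]
        rw [mvfderiv_fun_mul ((hf x).mdifferentiableAt (by simp)) (hT.mdifferentiableAt hY hZ x)]
        simp only [add_apply, smul_apply, smul_eq_mul]
        ring }
  have h2 : ∀ {Y : VField E M}, SmoothV Y → SmoothTensorialAt (fun Z => Φ Y Z) x := fun {Y} hY =>
    { add := fun {Z Z'} hZ hZ' => by
        simp only [hΦ, map_add, cov_add cov hZ hZ', add_apply]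
        rw [mvfderiv_fun_add (hT.mdifferentiableAt hY hZ x) (hT.mdifferentiableAt hY hZ' x),
          add_apply]
        ring
      smul := fun {f Z} hf hZ => by
        simp only [hΦ, map_smul, map_add, cov_smul cov hf hZ, smul_eq_mul]
        rw [mvfderiv_fun_mul ((hf x).mdifferentiableAt (by simp)) (hT.mdifferentiableAt hY hZ x)]
        simp only [add_apply, smul_apply, smul_eq_mul]
        ring }
  obtain ⟨V, hV, hV'⟩ := exists_smoothV_eventuallyEq_ext x (Y x)
  obtain ⟨W, hW, hW'⟩ := exists_smoothV_eventuallyEq_ext x (Z x)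
  have h3 : nablaForm cov T x u (Y x) (Z x) = Φ V W := by
    simp only [nablaForm, hΦ]
    rw [cov_congr cov (hV.mdifferentiableAt x) (hV'.mono fun y h => h.symm),
      cov_congr cov (hW.mdifferentiableAt x) (hW'.mono fun y h => h.symm),
      mvfderiv_congr (g := fun y => T y (V y) (W y))
        ((hV'.and hW').mono fun y h => by rw [h.1, h.2])]
    simp [hV'.self_of_nhds, hW'.self_of_nhds]
  rw [h3, (h1 hW).pointwise hV hY (by simp [hV'.self_of_nhds]),
    (h2 hY).pointwise hW hZ (by simp [hW'.self_of_nhds])]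

theorem IsParallelForm.mvfderiv_eq {cov : Conn E M} {T : FormField E M}
    (h : IsParallelForm cov T) (hT : SmoothForm T) {Y Z : VField E M}
    (hY : SmoothV Y) (hZ : SmoothV Z) (x : M) (u : TangentSpace 𝓘(ℝ, E) x) :
    mvfderiv 𝓘(ℝ, E) (fun y => T y (Y y) (Z y)) x u
      = T x (cov Y x u) (Z x) + T x (Y x) (cov Z x u) := by
  have := nablaForm_eq cov hT hY hZ x u
  rw [h] at this
  linarith

/-- The covariant derivative of a smooth form as a trilinear map. -/
def nablaFormLin (cov : Conn E M) {T : FormField E M} (hT : SmoothForm T) (x : M) :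
    TangentSpace 𝓘(ℝ, E) x →ₗ[ℝ] LinearMap.BilinForm ℝ (TangentSpace 𝓘(ℝ, E) x) where
  toFun u := LinearMap.mk₂ ℝ (fun v w => nablaForm cov T x u v w)
    (fun v v' w => by
      obtain ⟨V, hV, rfl⟩ := exists_smoothV_apply_eq x v
      obtain ⟨V', hV', rfl⟩ := exists_smoothV_apply_eq x v'
      obtain ⟨W, hW, rfl⟩ := exists_smoothV_apply_eq x w
      have := nablaForm_eq cov hT (hV.add hV') hW x u
      simp only [map_add, LinearMap.add_apply, cov_add cov hV hV', add_apply] at this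
      rw [this, nablaForm_eq cov hT hV hW, nablaForm_eq cov hT hV' hW,
        mvfderiv_fun_add (hT.mdifferentiableAt hV hW x) (hT.mdifferentiableAt hV' hW x), add_apply]
      ring)
    (fun c v w => by
      obtain ⟨V, hV, rfl⟩ := exists_smoothV_apply_eq x v
      obtain ⟨W, hW, rfl⟩ := exists_smoothV_apply_eq x w
      have := nablaForm_eq cov hT (hV.const_smul c) hW x u
      simp only [map_smul, LinearMap.smul_apply, cov_const_smul cov c hV, smul_eq_mul,
        smul_apply] at this
      rw [this, nablaForm_eq cov hT hV hW,
        mvfderiv_fun_mul mdifferentiableAt_const (hT.mdifferentiableAt hV hW x), mvfderiv_const]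
      simp only [add_apply, smul_apply, smul_eq_mul, smul_zero, zero_apply]
      ring)
    (fun v w w' => by
      obtain ⟨V, hV, rfl⟩ := exists_smoothV_apply_eq x v
      obtain ⟨W, hW, rfl⟩ := exists_smoothV_apply_eq x w
      obtain ⟨W', hW', rfl⟩ := exists_smoothV_apply_eq x w'
      have := nablaForm_eq cov hT hV (hW.add hW') x u
      simp only [map_add, cov_add cov hW hW', add_apply] at this
      rw [this, nablaForm_eq cov hT hV hW, nablaForm_eq cov hT hV hW',
        mvfderiv_fun_add (hT.mdifferentiableAt hV hW x) (hT.mdifferentiableAt hV hW' x), add_apply]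
      ring)
    (fun c v w => by
      obtain ⟨V, hV, rfl⟩ := exists_smoothV_apply_eq x v
      obtain ⟨W, hW, rfl⟩ := exists_smoothV_apply_eq x w
      have := nablaForm_eq cov hT hV (hW.const_smul c) x u
      simp only [map_smul, cov_const_smul cov c hW, smul_eq_mul,
        smul_apply] at this
      rw [this, nablaForm_eq cov hT hV hW,
        mvfderiv_fun_mul mdifferentiableAt_const (hT.mdifferentiableAt hV hW x), mvfderiv_const]
      simp only [add_apply, smul_apply, smul_eq_mul, smul_zero, zero_apply]
      ring)
  map_add' u u' := by
    ext v w
    simp only [LinearMap.mk₂_apply, LinearMap.add_apply, nablaForm, map_add]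
    ring
  map_smul' c u := by
    ext v w
    simp only [LinearMap.mk₂_apply, LinearMap.smul_apply, nablaForm, map_smul, RingHom.id_apply,
      smul_eq_mul]
    ring

@[simp]
theorem nablaFormLin_apply (cov : Conn E M) {T : FormField E M} (hT : SmoothForm T) (x : M)
    (u v w : TangentSpace 𝓘(ℝ, E) x) : nablaFormLin cov hT x u v w = nablaForm cov T x u v w :=
  rfl

/-! ### Raising indices -/

theorem contMDiffAt_det {ι : Type*} [Fintype ι] [DecidableEq ι] {G : M → Matrix ι ι ℝ} {x : M}
    (hG : ∀ i j, ContMDiffAt 𝓘(ℝ, E) 𝓘(ℝ, ℝ) ∞ (fun y => G y i j) x) :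
    ContMDiffAt 𝓘(ℝ, E) 𝓘(ℝ, ℝ) ∞ (fun y => (G y).det) x := by
  simp only [Matrix.det_apply']
  exact ContMDiffAt.sum fun σ _ => contMDiffAt_const.mul (contMDiffAt_finsetProd fun i _ => hG _ _)

theorem contMDiffAt_inv {ι : Type*} [Fintype ι] [DecidableEq ι] {G : M → Matrix ι ι ℝ} {x : M}
    (hG : ∀ i j, ContMDiffAt 𝓘(ℝ, E) 𝓘(ℝ, ℝ) ∞ (fun y => G y i j) x) (hx : (G x).det ≠ 0)
    (i j : ι) : ContMDiffAt 𝓘(ℝ, E) 𝓘(ℝ, ℝ) ∞ (fun y => (G y)⁻¹ i j) x := by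
  simp only [Matrix.inv_def, Matrix.smul_apply, Matrix.adjugate_apply, smul_eq_mul,
    Ring.inverse_eq_inv']
  refine ContMDiffAt.mul ((contMDiffAt_det hG).inv₀ hx) (contMDiffAt_det fun k l => ?_)
  by_cases hk : k = j
  · subst hk
    simpa using contMDiffAt_const
  · simpa [Matrix.updateRow_ne hk] using hG k l

/-- In a smooth local frame the components of `X` are its pairings with the frame multiplied by the
inverse Gram matrix, whose entries are smooth. -/
theorem smoothV_of_smooth_pairing {Ω : FormField E M} (hΩ : SmoothForm Ω)
    (hnd : ∀ x, (Ω x).Nondegenerate) {X : VField E M}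
    (hX : ∀ Z : VField E M, SmoothV Z → ContMDiff 𝓘(ℝ, E) 𝓘(ℝ, ℝ) ∞ (fun x => Ω x (X x) (Z x))) :
    SmoothV X := by
  intro x
  obtain ⟨e, he, hb, -⟩ := exists_smooth_frame (E := E) x
  set G : M → Matrix (Fin (Module.finrank ℝ E)) (Fin (Module.finrank ℝ E)) ℝ :=
    fun y => Matrix.of fun i j => Ω y (e i y) (e j y) with hG
  have hGs : ∀ i j, ContMDiffAt 𝓘(ℝ, E) 𝓘(ℝ, ℝ) ∞ (fun y => G y i j) x := fun i j =>
    hΩ _ _ (he i) (he j) x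
  have hdet : ∀ᶠ y in 𝓝 x, (G y).det ≠ 0 := by
    filter_upwards [hb] with y hy
    obtain ⟨b, hb⟩ := hy
    have : G y = LinearMap.BilinForm.toMatrix b (Ω y) := by
      ext i j; simp [hG, hb, LinearMap.BilinForm.toMatrix_apply]
    rw [this]
    exact (LinearMap.BilinForm.nondegenerate_iff_det_ne_zero b).1 (hnd y)
  have hc : ∀ j, ContMDiffAt 𝓘(ℝ, E) 𝓘(ℝ, ℝ) ∞
      (fun y => ∑ i, Ω y (X y) (e i y) * (G y)⁻¹ i j) x := fun j =>
    ContMDiffAt.sum fun i _ => (hX _ (he i) x).mul (contMDiffAt_inv hGs hdet.self_of_nhds i j)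
  have h1 := ContMDiffAt.sum_section (s := Finset.univ) (fun j _ => (hc j).smul_section (he j x))
  refine h1.congr_of_eventuallyEq ?_
  filter_upwards [hb, hdet] with y hy hdy
  obtain ⟨b, hb⟩ := hy
  have h2 : ∀ i, Ω y (X y) (e i y) = ∑ k, b.repr (X y) k * G y k i := fun i => by
    conv_lhs => rw [← b.sum_repr (X y)]
    simp [hG, hb]
  have h3 : ∀ j, ∑ i, Ω y (X y) (e i y) * (G y)⁻¹ i j = b.repr (X y) j := fun j => by
    have h4 : Matrix.vecMul (Matrix.vecMul (b.repr (X y)) (G y)) (G y)⁻¹ = b.repr (X y) := by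
      rw [Matrix.vecMul_vecMul, Matrix.mul_nonsing_inv _ (isUnit_iff_ne_zero.2 hdy),
        Matrix.vecMul_one]
    have h5 := congrFun h4 j
    simp only [Matrix.vecMul, dotProduct] at h5
    simp only [h2]
    exact h5
  have h4 : X y = ∑ j, (∑ i, Ω y (X y) (e i y) * (G y)⁻¹ i j) • e j y := by
    rw [Finset.sum_congr rfl fun j _ => by rw [h3 j, ← hb j]]
    exact (b.sum_repr _).symm
  simpa using congrArg (Bundle.TotalSpace.mk' E (E := fun y : M => TangentSpace 𝓘(ℝ, E) y) y) h4

end Forms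

/-! ### Weyl flat symplectic connections: the Ricci tensor, its endomorphism and the Bianchi
identity. -/

section WeylFlat

variable {E : Type*} [NormedAddCommGroup E] [NormedSpace ℝ E] [FiniteDimensional ℝ E]
  [CompleteSpace E] {M : Type*} [TopologicalSpace M] [ChartedSpace E M]
  [IsManifold 𝓘(ℝ, E) ∞ M] [T2Space M]

/-- Weyl flat symplectic connections on a symplectic manifold of dimension `2n`. -/
structure IsWeylFlatSymplectic (n : ℕ) (Ω : FormField E M) (cov : Conn E M) : Prop where
  pos : 1 ≤ n
  finrank_eq : Module.finrank ℝ E = 2 * n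
  symplectic : IsSymplecticForm Ω
  connection : IsSymplecticConnection Ω cov
  weyl_eq_zero : IsWeylFlat n Ω cov

/-- The basis that is dual to `frame x` with respect to `Ω`, up to sign. -/
def dualFrame (Ω : FormField E M) (x : M) (p : Fin (Module.finrank ℝ E)) :
    TangentSpace 𝓘(ℝ, E) x := ∑ q, inv Ω x p q • frame x q

namespace IsWeylFlatSymplectic

variable {n : ℕ} {Ω : FormField E M} {cov : Conn E M}

theorem skew (h : IsWeylFlatSymplectic n Ω cov) (x : M) (u v : TangentSpace 𝓘(ℝ, E) x) :
    Ω x u v = -Ω x v u := by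
  rw [LinearMap.BilinForm.IsAlt.neg_eq (h.symplectic.alt x)]

theorem gram_det_ne_zero (h : IsWeylFlatSymplectic n Ω cov) (x : M) :
    (Matrix.of fun i j => Ω x (frame x i) (frame x j)).det ≠ 0 := by
  have : (Matrix.of fun i j => Ω x (frame x i) (frame x j))
      = LinearMap.BilinForm.toMatrix (frame x) (Ω x) := by
    ext i j; simp [LinearMap.BilinForm.toMatrix_apply]
  rw [this]
  exact (LinearMap.BilinForm.nondegenerate_iff_det_ne_zero (frame x)).1
    (h.symplectic.nondegenerate x)

theorem isSymplecticDual (h : IsWeylFlatSymplectic n Ω cov) (x : M) :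
    IsSymplecticDual (Ω x) (frame x) (dualFrame Ω x) where
  alt := h.symplectic.alt x
  dual p q := by
    have h1 := Matrix.nonsing_inv_mul _ (isUnit_iff_ne_zero.2 (h.gram_det_ne_zero x))
    have h2 := congrFun (congrFun h1 p) q
    rw [Matrix.mul_apply, Matrix.one_apply] at h2
    simp only [dualFrame, map_sum, map_smul, LinearMap.sum_apply, LinearMap.smul_apply, inv,
      Matrix.neg_apply, smul_eq_mul, neg_mul, Finset.sum_neg_distrib]
    simp only [Matrix.of_apply] at h2
    rw [h2]
    split_ifs <;> simp

theorem card_eq (h : IsWeylFlatSymplectic n Ω cov) :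
    Fintype.card (Fin (Module.finrank ℝ E)) = 2 * n := by
  rw [Fintype.card_fin, h.finrank_eq]

theorem inv_skew (h : IsWeylFlatSymplectic n Ω cov) (x : M) (p q : Fin (Module.finrank ℝ E)) :
    inv Ω x p q = -inv Ω x q p := by
  have h1 : ∀ r s, Ω x (dualFrame Ω x r) (dualFrame Ω x s) = -inv Ω x s r := fun r s => by
    conv_lhs => rw [dualFrame.eq_1 Ω x s]
    simp [(h.isSymplecticDual x).dual]
  have h2 := h.skew x (dualFrame Ω x q) (dualFrame Ω x p)
  rw [h1, h1] at h2
  linarith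

theorem omega_curv (h : IsWeylFlatSymplectic n Ω cov) (x : M)
    (u v w z : TangentSpace 𝓘(ℝ, E) x) : Ω x (curv cov x u v w) z
      = 1 / ((n : ℝ) + 1) * modelForm (Ω x) (ricci cov x) u v w z :=
  sub_eq_zero.1 (h.weyl_eq_zero x u v w z)

theorem _root_.SymplecticConnection.ricci_frame (cov : Conn E M) (x : M)
    (i j : Fin (Module.finrank ℝ E)) : ricci cov x (frame x i) (frame x j)
      = ∑ p, (frame x).coord p (curv cov x (frame x p) (frame x i) (frame x j)) := by
  rw [ricci, ← LinearMap.BilinForm.toMatrix_apply (frame x), LinearMap.BilinForm.toMatrix_toBilin]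
  rfl

theorem ricci_symm (h : IsWeylFlatSymplectic n Ω cov) (x : M) (u v : TangentSpace 𝓘(ℝ, E) x) :
    ricci cov x u v = ricci cov x v u :=
  ricci_symm_of_weyl_eq_zero (h.isSymplecticDual x) h.card_eq (h.omega_curv x)
    (ricci_frame cov x) u v

theorem omega_ricciEnd (h : IsWeylFlatSymplectic n Ω cov) (x : M)
    (u v : TangentSpace 𝓘(ℝ, E) x) : Ω x (ricciEnd Ω cov x u) v = ricci cov x u v := by
  have h1 : (Ω x).compLeft (ricciEnd Ω cov x) = ricci cov x := by
    refine LinearMap.BilinForm.ext_basis (frame x) fun i j => ?_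
    have h2 : ricciEnd Ω cov x (frame x i)
        = -∑ p, ricci cov x (frame x i) (frame x p) • dualFrame Ω x p := by
      rw [ricciEnd, Matrix.toLin_self]
      simp only [Matrix.of_apply, Finset.sum_smul, dualFrame, Finset.smul_sum,
        ← Finset.sum_neg_distrib]
      rw [Finset.sum_comm]
      refine Finset.sum_congr rfl fun p _ => Finset.sum_congr rfl fun q _ => ?_
      rw [h.inv_skew x q p, smul_smul, ← neg_smul]
      congr 1
      ring
    rw [LinearMap.BilinForm.compLeft_apply, h2]
    simp [(h.isSymplecticDual x).dual]
  exact congrArg (fun L : LinearMap.BilinForm ℝ (TangentSpace 𝓘(ℝ, E) x) => L u v) h1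

theorem curv_eq (h : IsWeylFlatSymplectic n Ω cov) (x : M) (u v w : TangentSpace 𝓘(ℝ, E) x) :
    curv cov x u v w = (1 / (2 * ((n : ℝ) + 1))) •
      (Ω x u w • ricciEnd Ω cov x v + ricci cov x v w • u - Ω x v w • ricciEnd Ω cov x u
        - ricci cov x u w • v + (2 * Ω x u v) • ricciEnd Ω cov x w) :=
  weylFlat_curv_eq (h.symplectic.nondegenerate x) (h.omega_ricciEnd x) (h.ricci_symm x)
    (h.omega_curv x) u v w

theorem exists_omega_ne_zero (h : IsWeylFlatSymplectic n Ω cov) (x : M)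
    {u : TangentSpace 𝓘(ℝ, E) x} (hu : u ≠ 0) : ∃ v, Ω x u v ≠ 0 := by
  by_contra hcon
  push Not at hcon
  exact hu ((h.symplectic.nondegenerate x).1 u hcon)

theorem exists_ne_zero (h : IsWeylFlatSymplectic n Ω cov) (x : M) :
    ∃ u : TangentSpace 𝓘(ℝ, E) x, u ≠ 0 := by
  have : 0 < Module.finrank ℝ (TangentSpace 𝓘(ℝ, E) x) := by
    change 0 < Module.finrank ℝ E
    have := h.pos
    rw [h.finrank_eq]; omega
  have := Module.nontrivial_of_finrank_pos this
  exact exists_ne 0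

/-! ### Smoothness of the Ricci tensor -/

/-- `ricci` is a trace over `frame`, which need not vary continuously with the point, so smoothness
cannot be read off the definition. Weyl flatness gives instead Ω(R(X,Y)X, X) = 2/(n+1) · Ω(X,Y)
Ric(X,X), which can be solved for Ric(X,X) where Ω(X,Y) ≠ 0. -/
theorem contMDiffAt_ricci_self (h : IsWeylFlatSymplectic n Ω cov) {X : VField E M}
    (hX : SmoothV X) (x : M) (hx : X x ≠ 0) :
    ContMDiffAt 𝓘(ℝ, E) 𝓘(ℝ, ℝ) ∞ (fun y => ricci cov y (X y) (X y)) x := by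
  obtain ⟨v, hv⟩ := h.exists_omega_ne_zero x hx
  obtain ⟨Y, hY, rfl⟩ := exists_smoothV_apply_eq x v
  have h1 : ContMDiff 𝓘(ℝ, E) 𝓘(ℝ, ℝ) ∞ (fun y => Ω y (X y) (Y y)) :=
    h.symplectic.smooth _ _ hX hY
  have h2 : ContMDiff 𝓘(ℝ, E) 𝓘(ℝ, ℝ) ∞ (fun y => Ω y (curvOp cov X Y X y) (X y)) :=
    h.symplectic.smooth _ _ (smoothV_curvOp h.connection.smooth hX hY hX) hX
  have h3 : ∀ᶠ y in 𝓝 x, Ω y (X y) (Y y) ≠ 0 := h1.continuous.continuousAt.eventually_ne hv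
  refine ((contMDiffAt_const (c := ((n : ℝ) + 1) / 2)).mul
    ((h2 x).mul ((h1 x).inv₀ hv))).congr_of_eventuallyEq ?_
  filter_upwards [h3] with y hy
  have h4 : Ω y (X y) (X y) = 0 := (h.symplectic.alt y).self_eq_zero _
  have h5 : (n : ℝ) + 1 ≠ 0 := by positivity
  simp only [Pi.mul_apply]
  rw [curvOp_eq_curv h.connection.smooth hX hY hX, h.omega_curv, modelForm, h4,
    h.skew y (Y y) (X y)]
  field_simp
  ring

theorem smoothForm_ricci (h : IsWeylFlatSymplectic n Ω cov) : SmoothForm (ricci cov) := by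
  have h1 : ∀ X : VField E M, SmoothV X → ∀ x, ContMDiffAt 𝓘(ℝ, E) 𝓘(ℝ, ℝ) ∞
      (fun y => ricci cov y (X y) (X y)) x := fun X hX x => by
    by_cases hx : X x = 0
    -- Where `X` vanishes, the parallelogram law expresses Ric(X,X) through `X + F`, `X - F` and
    -- `F`, all nonzero at `x`.
    · obtain ⟨u, hu⟩ := h.exists_ne_zero x
      obtain ⟨F, hF, rfl⟩ := exists_smoothV_apply_eq x u
      have h2 := h.contMDiffAt_ricci_self (hX.add hF) x (by simpa [hx] using hu)
      have h3 := h.contMDiffAt_ricci_self (hX.sub hF) x (by simpa [hx] using hu)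
      have h4 := h.contMDiffAt_ricci_self hF x hu
      refine (((contMDiffAt_const (c := (1 / 2 : ℝ))).mul (h2.add h3)).sub h4).congr_of_eventuallyEq
        (Filter.Eventually.of_forall fun y => ?_)
      simp only [map_add, map_sub, LinearMap.add_apply, LinearMap.sub_apply, Pi.add_apply,
        Pi.mul_apply]
      ring
    · exact h.contMDiffAt_ricci_self hX x hx
  intro X Y hX hY x
  refine ((contMDiffAt_const (c := (1 / 2 : ℝ))).mul
    (((h1 _ (hX.add hY) x).sub (h1 _ hX x)).sub (h1 _ hY x))).congr_of_eventuallyEq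
      (Filter.Eventually.of_forall fun y => ?_)
  simp only [map_add, LinearMap.add_apply, Pi.mul_apply]
  rw [h.ricci_symm y (Y y) (X y)]
  ring

theorem smoothEnd_ricciEnd (h : IsWeylFlatSymplectic n Ω cov) : SmoothEnd (ricciEnd Ω cov) :=
  fun X hX => smoothV_of_smooth_pairing h.symplectic.smooth h.symplectic.nondegenerate
    fun Z hZ => by
      simp only [h.omega_ricciEnd]
      exact h.smoothForm_ricci X Z hX hZ

end IsWeylFlatSymplectic

/-! ### The differential Bianchi identity -/

/-- `U`, `V`, `W` are required to have the germs of the constant-coefficient extensions, so that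
`nablaCurv` unfolds directly; `A` may be any smooth field, since it only enters through its value at
`x`. -/
theorem nablaCurv_eq {cov : Conn E M}
    (hcov : CovariantDerivative.ContMDiffCovariantDerivative cov ∞) {x : M}
    {A U V W : VField E M} (hA : SmoothV A) (hU : SmoothV U) (hV : SmoothV V) (hW : SmoothV W)
    (hU' : ∀ᶠ y in 𝓝 x, U y = ext x (U x) y) (hV' : ∀ᶠ y in 𝓝 x, V y = ext x (V x) y)
    (hW' : ∀ᶠ y in 𝓝 x, W y = ext x (W x) y) :
    nablaCurv cov x (A x) (U x) (V x) (W x) = cov (curvOp cov U V W) x (A x)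
      - curvOp cov (fun y => cov U y (A y)) V W x - curvOp cov U (fun y => cov V y (A y)) W x
      - curvOp cov U V (fun y => cov W y (A y)) x := by
  have e : ∀ {X : VField E M}, (∀ᶠ y in 𝓝 x, X y = ext x (X x) y) →
      ∀ᶠ y in 𝓝 x, ext x (X x) y = X y := fun h => h.mono fun y hy => hy.symm
  rw [curvOp_eq_curv hcov (hA.cov hcov hU) hV hW, curvOp_eq_curv hcov hU (hA.cov hcov hV) hW,
    curvOp_eq_curv hcov hU hV (hA.cov hcov hW), nablaCurv,
    cov_congr cov (hU.mdifferentiableAt x) (e hU'), cov_congr cov (hV.mdifferentiableAt x) (e hV'),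
    cov_congr cov (hW.mdifferentiableAt x) (e hW'),
    cov_congr cov ((smoothV_curvOp hcov hU hV hW).mdifferentiableAt x)
      (curvOp_congr_germ hcov hU hV hW (e hU') (e hV') (e hW'))]

/-- By torsion-freeness the differences ∇_A U - ∇_U A are brackets. All iterated covariant
derivatives of `W` then cancel, and what is left is the Jacobi identity for the brackets of `A`,
`U`, `V`. -/
theorem bianchi_curvOp {cov : Conn E M}
    (hcov : CovariantDerivative.ContMDiffCovariantDerivative cov ∞) (htor : cov.torsion = 0)
    {A U V W : VField E M} (hA : SmoothV A) (hU : SmoothV U) (hV : SmoothV V) (hW : SmoothV W)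
    (x : M) :
    (cov (curvOp cov U V W) x (A x)
      - curvOp cov (fun y => cov U y (A y)) V W x - curvOp cov U (fun y => cov V y (A y)) W x
      - curvOp cov U V (fun y => cov W y (A y)) x)
    + (cov (curvOp cov V A W) x (U x)
      - curvOp cov (fun y => cov V y (U y)) A W x - curvOp cov V (fun y => cov A y (U y)) W x
      - curvOp cov V A (fun y => cov W y (U y)) x)
    + (cov (curvOp cov A U W) x (V x)
      - curvOp cov (fun y => cov A y (V y)) U W x - curvOp cov A (fun y => cov U y (V y)) W x
      - curvOp cov A U (fun y => cov W y (V y)) x) = 0 := by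
  have hb : ∀ {X Y : VField E M}, SmoothV X → SmoothV Y →
      bracket X Y = fun y => cov Y y (X y) - cov X y (Y y) := fun hX hY => by
    funext y; exact bracket_eq htor hX hY y
  have hc : ∀ {X Y Z : VField E M}, SmoothV X → SmoothV Y → SmoothV Z →
      curvOp cov (bracket X Y) Z W x
        = curvOp cov (fun y => cov Y y (X y)) Z W x - curvOp cov (fun y => cov X y (Y y)) Z W x :=
    fun {X Y Z} hX hY hZ => by
      rw [hb hX hY]
      exact (tensorial_curvOp_left hcov hW x).sub (hX.cov hcov hY) (hY.cov hcov hX)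
  have hd : ∀ {X Y Z : VField E M}, SmoothV X → SmoothV Y → SmoothV Z →
      cov (curvOp cov X Y W) x (Z x) = cov (fun y => cov (fun y => cov W y (Y y)) y (X y)) x (Z x)
        - cov (fun y => cov (fun y => cov W y (X y)) y (Y y)) x (Z x)
        - cov (fun y => cov W y (bracket X Y y)) x (Z x) := fun {X Y Z} hX hY hZ => by
    have h1 : SmoothV fun y => cov (fun y => cov W y (Y y)) y (X y) :=
      hX.cov hcov (hY.cov hcov hW)
    have h2 : SmoothV fun y => cov (fun y => cov W y (X y)) y (Y y) :=
      hY.cov hcov (hX.cov hcov hW)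
    have h3 : SmoothV fun y => cov W y (bracket X Y y) := (hX.bracket hY).cov hcov hW
    have h4 := cov_sub cov (h1.sub h2) h3 x
    rw [cov_sub cov h1 h2] at h4
    exact congrArg (fun L => L (Z x)) h4
  have hj : cov W x (bracket (bracket A U) V x) + cov W x (bracket (bracket U V) A x)
      + cov W x (bracket (bracket V A) U x) = 0 := by
    have h1 := bracket_jacobi hA hU hV x
    have h2 : bracket (bracket U V) A x = -bracket A (bracket U V) x :=
      VectorField.mlieBracket_swap_apply
    have h3 : bracket (bracket V A) U x = bracket U (bracket A V) x := by
      rw [show bracket V A = -bracket A V from VectorField.mlieBracket_swap]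
      have h5 : bracket (-bracket A V) U x = -bracket U (-bracket A V) x :=
        VectorField.mlieBracket_swap_apply
      have h6 : bracket U (-bracket A V) x = - bracket U (bracket A V) x := by
        have := VectorField.mlieBracket_const_smul_right (I := 𝓘(ℝ, E)) (V := U) (c := (-1 : ℝ))
          ((hA.bracket hV).mdifferentiableAt x)
        simpa using this
      rw [h5, h6, neg_neg]
    rw [← map_add, ← map_add, h2, h3, h1]
    convert map_zero (cov W x) using 2
    abel
  have s1 := curvOp_swap (cov := cov) U (fun y => cov V y (A y)) W x
  have s2 := curvOp_swap (cov := cov) V (fun y => cov A y (U y)) W x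
  have s3 := curvOp_swap (cov := cov) A (fun y => cov U y (V y)) W x
  have c1 := hc hA hU hV
  have c2 := hc hU hV hA
  have c3 := hc hV hA hU
  rw [s1, s2, s3, hd hU hV hA, hd hV hA hU, hd hA hU hV]
  simp only [curvOp] at c1 c2 c3 ⊢
  rw [← sub_eq_zero] at c1 c2 c3
  -- The whole identity is the sum of the three bracket relations and the Jacobi identity.
  have hs := congr($c1 + $c2 + $c3 + $hj)
  refine Eq.trans ?_ (hs.trans (by simp))
  abel

end WeylFlat

/-! ### The equivalence of vanishing curvature one-form, parallel Ricci tensor and local symmetry.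
-/

section Equivalences

variable {E : Type*} [NormedAddCommGroup E] [NormedSpace ℝ E] [FiniteDimensional ℝ E]
  [CompleteSpace E] {M : Type*} [TopologicalSpace M] [ChartedSpace E M]
  [IsManifold 𝓘(ℝ, E) ∞ M] [T2Space M]

theorem mvfderiv_fun_combination {p₁ p₂ p₃ p₄ p₅ : M → ℝ} {x : M}
    (h₁ : MDifferentiableAt 𝓘(ℝ, E) 𝓘(ℝ, ℝ) p₁ x) (h₂ : MDifferentiableAt 𝓘(ℝ, E) 𝓘(ℝ, ℝ) p₂ x)
    (h₃ : MDifferentiableAt 𝓘(ℝ, E) 𝓘(ℝ, ℝ) p₃ x) (h₄ : MDifferentiableAt 𝓘(ℝ, E) 𝓘(ℝ, ℝ) p₄ x)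
    (h₅ : MDifferentiableAt 𝓘(ℝ, E) 𝓘(ℝ, ℝ) p₅ x) (k : ℝ) (a : TangentSpace 𝓘(ℝ, E) x) :
    mvfderiv 𝓘(ℝ, E)
        (fun y => k * ((p₁ y + p₂ y) / 2 - (p₃ y + p₄ y) / 2 + p₅ y)) x a
      = k * ((mvfderiv 𝓘(ℝ, E) p₁ x a + mvfderiv 𝓘(ℝ, E) p₂ x a) / 2
        - (mvfderiv 𝓘(ℝ, E) p₃ x a + mvfderiv 𝓘(ℝ, E) p₄ x a) / 2 + mvfderiv 𝓘(ℝ, E) p₅ x a) := by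
  have hc : ∀ c : ℝ, MDifferentiableAt 𝓘(ℝ, E) 𝓘(ℝ, ℝ) (fun _ : M => c) x :=
    fun c => mdifferentiableAt_const
  have e : (fun y => k * ((p₁ y + p₂ y) / 2 - (p₃ y + p₄ y) / 2 + p₅ y))
      = fun y => k * ((1 / 2) * (p₁ y + p₂ y) + ((-1 / 2) * (p₃ y + p₄ y) + p₅ y)) := by
    funext y; ring
  have s12 : MDifferentiableAt 𝓘(ℝ, E) 𝓘(ℝ, ℝ) (fun y => p₁ y + p₂ y) x := h₁.add h₂
  have s34 : MDifferentiableAt 𝓘(ℝ, E) 𝓘(ℝ, ℝ) (fun y => p₃ y + p₄ y) x := h₃.add h₄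
  have h12 : MDifferentiableAt 𝓘(ℝ, E) 𝓘(ℝ, ℝ) (fun y => 1 / 2 * (p₁ y + p₂ y)) x :=
    (hc _).mul s12
  have h34 : MDifferentiableAt 𝓘(ℝ, E) 𝓘(ℝ, ℝ) (fun y => -1 / 2 * (p₃ y + p₄ y)) x :=
    (hc _).mul s34
  have h345 : MDifferentiableAt 𝓘(ℝ, E) 𝓘(ℝ, ℝ) (fun y => -1 / 2 * (p₃ y + p₄ y) + p₅ y) x :=
    h34.add h₅
  have hs : MDifferentiableAt 𝓘(ℝ, E) 𝓘(ℝ, ℝ)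
      (fun y => 1 / 2 * (p₁ y + p₂ y) + (-1 / 2 * (p₃ y + p₄ y) + p₅ y)) x := h12.add h345
  rw [e, mvfderiv_fun_mul (hc k) hs, mvfderiv_fun_add h12 h345, mvfderiv_fun_add h34 h₅,
    mvfderiv_fun_mul (hc _) s12, mvfderiv_fun_mul (hc _) s34, mvfderiv_fun_add h₁ h₂,
    mvfderiv_fun_add h₃ h₄]
  simp only [mvfderiv_const, add_apply, smul_apply, smul_eq_mul, smul_zero, add_zero]
  ring

theorem mvfderiv_mul_parallelForm {cov : Conn E M} {Ω T : FormField E M} (hΩ : SmoothForm Ω)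
    (hp : IsParallelForm cov Ω) (hT : SmoothForm T) {X Y Z W : VField E M}
    (hX : SmoothV X) (hY : SmoothV Y) (hZ : SmoothV Z) (hW : SmoothV W) (x : M)
    (a : TangentSpace 𝓘(ℝ, E) x) :
    mvfderiv 𝓘(ℝ, E) (fun y => Ω y (X y) (Y y) * T y (Z y) (W y)) x a
      = (Ω x (cov X x a) (Y x) + Ω x (X x) (cov Y x a)) * T x (Z x) (W x)
        + Ω x (X x) (Y x) * (nablaForm cov T x a (Z x) (W x) + T x (cov Z x a) (W x)
          + T x (Z x) (cov W x a)) := by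
  rw [mvfderiv_fun_mul (hΩ.mdifferentiableAt hX hY x) (hT.mdifferentiableAt hZ hW x),
    nablaForm_eq cov hT hZ hW]
  simp only [add_apply, smul_apply, smul_eq_mul]
  rw [hp.mvfderiv_eq hΩ hX hY]
  ring

namespace IsWeylFlatSymplectic

variable {n : ℕ} {Ω : FormField E M} {cov : Conn E M}

/-- The covariant derivative passes through the Weyl flat formula because `Ω` is parallel, so only
Ric is differentiated. In the computation, the derivatives of the arguments match the correction
terms of ∇R. -/
theorem omega_nablaCurv (h : IsWeylFlatSymplectic n Ω cov) (x : M)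
    (a u v w z : TangentSpace 𝓘(ℝ, E) x) : Ω x (nablaCurv cov x a u v w) z
      = 1 / ((n : ℝ) + 1)
        * modelForm (Ω x) (nablaFormLin cov h.smoothForm_ricci x a) u v w z := by
  have hcov := h.connection.smooth
  obtain ⟨A, hA, rfl⟩ := exists_smoothV_apply_eq x a
  obtain ⟨Z, hZ, rfl⟩ := exists_smoothV_apply_eq x z
  obtain ⟨U, hU, hU'⟩ := exists_smoothV_eventuallyEq_ext x u
  obtain ⟨V, hV, hV'⟩ := exists_smoothV_eventuallyEq_ext x v
  obtain ⟨W, hW, hW'⟩ := exists_smoothV_eventuallyEq_ext x w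
  obtain rfl : U x = u := by simp [hU'.self_of_nhds]
  obtain rfl : V x = v := by simp [hV'.self_of_nhds]
  obtain rfl : W x = w := by simp [hW'.self_of_nhds]
  have hC := smoothV_curvOp hcov hU hV hW
  have hB := h.smoothForm_ricci
  have hO := h.symplectic.smooth
  have hp := h.connection.parallel
  have h1 := hp.mvfderiv_eq hO hC hZ x (A x)
  have h2 : (fun y => Ω y (curvOp cov U V W y) (Z y)) = fun y => 1 / ((n : ℝ) + 1) *
      ((Ω y (U y) (W y) * ricci cov y (Z y) (V y) + Ω y (U y) (Z y) * ricci cov y (W y) (V y)) / 2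
        - (Ω y (V y) (W y) * ricci cov y (Z y) (U y)
          + Ω y (V y) (Z y) * ricci cov y (W y) (U y)) / 2
        + Ω y (U y) (V y) * ricci cov y (W y) (Z y)) := by
    funext y
    rw [curvOp_eq_curv hcov hU hV hW, h.omega_curv]
    rfl
  have hd : ∀ {X Y Z W : VField E M}, SmoothV X → SmoothV Y → SmoothV Z → SmoothV W →
      MDifferentiableAt 𝓘(ℝ, E) 𝓘(ℝ, ℝ)
        (fun y => Ω y (X y) (Y y) * ricci cov y (Z y) (W y)) x := fun hX hY hZ hW =>
    (hO.mdifferentiableAt hX hY x).mul (hB.mdifferentiableAt hZ hW x)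
  rw [h2, mvfderiv_fun_combination (hd hU hW hZ hV) (hd hU hZ hW hV) (hd hV hW hZ hU)
    (hd hV hZ hW hU) (hd hU hV hW hZ)] at h1
  simp only [mvfderiv_mul_parallelForm hO hp hB hU hW hZ hV, mvfderiv_mul_parallelForm hO hp hB hU
    hZ hW hV, mvfderiv_mul_parallelForm hO hp hB hV hW hZ hU, mvfderiv_mul_parallelForm hO hp hB hV
    hZ hW hU, mvfderiv_mul_parallelForm hO hp hB hU hV hW hZ] at h1
  rw [nablaCurv_eq hcov hA hU hV hW hU' hV' hW',
    curvOp_eq_curv hcov (hA.cov hcov hU) hV hW, curvOp_eq_curv hcov hU (hA.cov hcov hV) hW,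
    curvOp_eq_curv hcov hU hV (hA.cov hcov hW)]
  rw [curvOp_eq_curv hcov hU hV hW] at h1
  simp only [map_sub, LinearMap.sub_apply, h.omega_curv] at h1 ⊢
  simp only [modelForm, nablaFormLin_apply] at h1 ⊢
  linear_combination -h1

theorem bianchi_modelForm (h : IsWeylFlatSymplectic n Ω cov) (x : M)
    (a u v w z : TangentSpace 𝓘(ℝ, E) x) :
    modelForm (Ω x) (nablaFormLin cov h.smoothForm_ricci x a) u v w z
      + modelForm (Ω x) (nablaFormLin cov h.smoothForm_ricci x u) v a w z
      + modelForm (Ω x) (nablaFormLin cov h.smoothForm_ricci x v) a u w z = 0 := by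
  have hcov := h.connection.smooth
  have hn : (n : ℝ) + 1 ≠ 0 := by positivity
  have h1 : nablaCurv cov x a u v w + nablaCurv cov x u v a w + nablaCurv cov x v a u w = 0 := by
    obtain ⟨A, hA, hA'⟩ := exists_smoothV_eventuallyEq_ext x a
    obtain ⟨U, hU, hU'⟩ := exists_smoothV_eventuallyEq_ext x u
    obtain ⟨V, hV, hV'⟩ := exists_smoothV_eventuallyEq_ext x v
    obtain ⟨W, hW, hW'⟩ := exists_smoothV_eventuallyEq_ext x w
    obtain rfl : A x = a := by simp [hA'.self_of_nhds]
    obtain rfl : U x = u := by simp [hU'.self_of_nhds]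
    obtain rfl : V x = v := by simp [hV'.self_of_nhds]
    obtain rfl : W x = w := by simp [hW'.self_of_nhds]
    rw [nablaCurv_eq hcov hA hU hV hW hU' hV' hW', nablaCurv_eq hcov hU hV hA hW hV' hA' hW',
      nablaCurv_eq hcov hV hA hU hW hA' hU' hW']
    exact bianchi_curvOp hcov h.connection.torsion_free hA hU hV hW x
  have h2 := congrArg (fun y => Ω x y z) h1
  simp only [map_add, LinearMap.add_apply, h.omega_nablaCurv, map_zero, LinearMap.zero_apply] at h2
  rw [← mul_add, ← mul_add] at h2
  exact (mul_eq_zero.1 h2).resolve_left (by positivity)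

theorem nablaForm_ricci_symm (h : IsWeylFlatSymplectic n Ω cov) (x : M)
    (a u v : TangentSpace 𝓘(ℝ, E) x) :
    nablaForm cov (ricci cov) x a u v = nablaForm cov (ricci cov) x a v u := by
  simp only [nablaForm, h.ricci_symm x (cov _ x a)]
  rw [funext fun y => h.ricci_symm y (ext x u y) (ext x v y)]
  simp only [h.ricci_symm x u]
  ring

theorem curvatureOneForm_eq (h : IsWeylFlatSymplectic n Ω cov) (x : M)
    (u : TangentSpace 𝓘(ℝ, E) x) : curvatureOneForm Ω cov x u
      = ∑ p, nablaFormLin cov h.smoothForm_ricci x (dualFrame Ω x p) u (frame x p) := by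
  simp [curvatureOneForm, dualFrame]

theorem parallel_of_curvatureOneForm (h : IsWeylFlatSymplectic n Ω cov) (hp : IsPreferred cov)
    (hρ : ∀ x u, curvatureOneForm Ω cov x u = 0) : IsParallelForm cov (ricci cov) := by
  intro x u v w
  have h1 : nablaFormLin cov h.smoothForm_ricci x = 0 := by
    refine nabla_eq_zero_of_bianchi (h.isSymplecticDual x) h.card_eq
      (fun a u v => h.nablaForm_ricci_symm x a u v) (fun a u v => ?_)
      (fun u => (h.curvatureOneForm_eq x u).symm.trans (hρ x u)) (h.bianchi_modelForm x)
    have := hp x a u v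
    simp only [nablaFormLin_apply]
    rw [h.nablaForm_ricci_symm x a v u, h.nablaForm_ricci_symm x u a v,
      h.nablaForm_ricci_symm x v u a] at this
    linarith
  rw [← nablaFormLin_apply cov h.smoothForm_ricci, h1]
  rfl

/-- Evaluating the formula for ∇R at (u,v,u,u) isolates 2Ω(u,v)(∇_a Ric)(u,u), and polarization
recovers all of ∇Ric. -/
theorem locallySymmetric_iff (h : IsWeylFlatSymplectic n Ω cov) :
    IsLocallySymmetric cov ↔ IsParallelForm cov (ricci cov) := by
  refine ⟨fun hs x a => ?_, fun hp x a u v w => (h.symplectic.nondegenerate x).1 _ fun z => ?_⟩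
  · have h1 : ∀ u, u ≠ 0 → nablaForm cov (ricci cov) x a u u = 0 := fun u hu => by
      obtain ⟨v, hv⟩ := h.exists_omega_ne_zero x hu
      have h2 := h.omega_nablaCurv x a u v u u
      rw [hs, map_zero, LinearMap.zero_apply] at h2
      have h3 := (mul_eq_zero.1 h2.symm).resolve_left (by positivity)
      simp only [modelForm, nablaFormLin_apply, (h.symplectic.alt x).self_eq_zero,
        h.skew x v u] at h3
      have h4 : Ω x u v * nablaForm cov (ricci cov) x a u u = 0 := by linarith
      exact (mul_eq_zero.1 h4).resolve_left hv
    have h2 : ∀ u, nablaFormLin cov h.smoothForm_ricci x a u u = 0 := fun u => by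
      by_cases hu : u = 0
      · simp [hu]
      · exact h1 u hu
    intro u v
    have h3 := h2 (u + v)
    simp only [map_add, LinearMap.add_apply, h2, nablaFormLin_apply,
      h.nablaForm_ricci_symm x a v u] at h3
    linarith
  · have h1 : nablaFormLin cov h.smoothForm_ricci x a = 0 := by
      refine LinearMap.ext fun u => LinearMap.ext fun v => ?_
      exact hp x a u v
    rw [h.omega_nablaCurv, h1]
    simp [modelForm]

theorem tfae (h : IsWeylFlatSymplectic n Ω cov) (hp : IsPreferred cov) :
    List.TFAE [∀ x u, curvatureOneForm Ω cov x u = 0, IsParallelForm cov (ricci cov),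
      IsLocallySymmetric cov] := by
  tfae_have 1 → 2 := h.parallel_of_curvatureOneForm hp
  tfae_have 2 → 1 := fun hr x u => by simp [curvatureOneForm, hr x]
  tfae_have 2 ↔ 3 := h.locallySymmetric_iff.symm
  tfae_finish

end IsWeylFlatSymplectic
end Equivalences

/-! ### Straight segments in a chart, and functions with zero derivative. -/

section Radial

variable {E : Type*} [NormedAddCommGroup E] [NormedSpace ℝ E] [FiniteDimensional ℝ E]
  {M : Type*} [TopologicalSpace M] [ChartedSpace E M] [IsManifold 𝓘(ℝ, E) ∞ M]

/-- The inverse trivialization is the differential of the inverse chart, so a chart segment with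
direction `w` has velocity `symmL w`. -/
theorem hasDerivAt_comp_radial {x : M} {p w : E} {t : ℝ}
    (h : p + t • w ∈ (extChartAt 𝓘(ℝ, E) x).target) {f : M → ℝ}
    (hf : MDifferentiableAt 𝓘(ℝ, E) 𝓘(ℝ, ℝ) f ((extChartAt 𝓘(ℝ, E) x).symm (p + t • w))) :
    HasDerivAt (fun s : ℝ => f ((extChartAt 𝓘(ℝ, E) x).symm (p + s • w)))
      (mvfderiv 𝓘(ℝ, E) f ((extChartAt 𝓘(ℝ, E) x).symm (p + t • w))
        ((trivializationAt E (TangentSpace 𝓘(ℝ, E)) x).symmL ℝ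
          ((extChartAt 𝓘(ℝ, E) x).symm (p + t • w)) w)) t := by
  have h1 : (extChartAt 𝓘(ℝ, E) x).symm (p + t • w) ∈ (chartAt E x).source := by
    have := (extChartAt 𝓘(ℝ, E) x).map_target h
    rwa [extChartAt_source] at this
  have hd : MDifferentiableAt 𝓘(ℝ, E) 𝓘(ℝ, E) (extChartAt 𝓘(ℝ, E) x).symm (p + t • w) := by
    have := mdifferentiableWithinAt_extChartAt_symm (I := 𝓘(ℝ, E)) h
    rwa [modelWithCornersSelf_coe, Set.range_id, mdifferentiableWithinAt_univ] at this
  have h2 := TangentBundle.symmL_trivializationAt (I := 𝓘(ℝ, E)) (𝕜 := ℝ) h1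
  rw [(extChartAt 𝓘(ℝ, E) x).right_inv h] at h2
  have h3 : HasMFDerivAt 𝓘(ℝ, E) 𝓘(ℝ, ℝ) (f ∘ (extChartAt 𝓘(ℝ, E) x).symm) (p + t • w) _ :=
    hf.hasMFDerivAt.comp (p + t • w) hd.hasMFDerivAt
  have h4 := h3.hasFDerivAt
  have h5 : HasDerivAt (fun s : ℝ => p + s • w) w t := by
    simpa using ((hasDerivAt_id t).smul_const w).const_add p
  have h6 := h4.comp_hasDerivAt t h5
  rw [h2]
  simp only [modelWithCornersSelf_coe, Set.range_id, mfderivWithin_univ]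
  exact h6

/-- A smooth frame near `x`, and curves from `x` to all points near `x` whose velocities have
constant coefficients in that frame. -/
theorem exists_radial_frame [T2Space M] (x : M) :
    ∃ e : Fin (Module.finrank ℝ E) → VField E M, (∀ i, SmoothV (e i)) ∧
      (∀ᶠ y in 𝓝 x, ∃ b : Module.Basis (Fin (Module.finrank ℝ E)) ℝ (TangentSpace 𝓘(ℝ, E) y),
        ∀ i, b i = e i y) ∧
      (∀ X : VField E M, SmoothV X → ∃ c : Fin (Module.finrank ℝ E) → M → ℝ,
        (∀ i, ContMDiff 𝓘(ℝ, E) 𝓘(ℝ, ℝ) ∞ (c i)) ∧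
        (∀ᶠ y in 𝓝 x, X y = ∑ i, c i y • e i y)) ∧
      ∀ P : M → Prop, (∀ᶠ y in 𝓝 x, P y) → ∀ᶠ y in 𝓝 x, ∃ (γ : ℝ → M)
        (v : Fin (Module.finrank ℝ E) → ℝ), γ 0 = x ∧ γ 1 = y ∧
        ∀ t ∈ Set.Icc (0 : ℝ) 1, P (γ t) ∧ ∀ f : M → ℝ,
          MDifferentiableAt 𝓘(ℝ, E) 𝓘(ℝ, ℝ) f (γ t) →
            HasDerivAt (fun s => f (γ s)) (∑ l, v l * mvfderiv 𝓘(ℝ, E) f (γ t) (e l (γ t))) t := by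
  obtain ⟨e, he, hb, hc, hs⟩ := exists_smooth_frame (E := E) x
  refine ⟨e, he, hb, fun X hX => ?_, fun P hP => ?_⟩
  · obtain ⟨c, h1, h2, -⟩ := hc X hX
    exact ⟨c, h1, h2⟩
  set φ := extChartAt 𝓘(ℝ, E) x with hφ
  have h1 : ∀ᶠ p in 𝓝 (φ x), p ∈ φ.target ∧ P (φ.symm p) ∧ ∀ i, e i (φ.symm p)
      = (trivializationAt E (TangentSpace 𝓘(ℝ, E)) x).symmL ℝ (φ.symm p)
        (Module.finBasis ℝ E i) := by
    have h2 : Filter.Tendsto φ.symm (𝓝 (φ x)) (𝓝 x) := by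
      have := continuousAt_extChartAt_symm (I := 𝓘(ℝ, E)) x
      rwa [ContinuousAt, extChartAt_to_inv] at this
    have h3 : ∀ᶠ p in 𝓝 (φ x), p ∈ φ.target := extChartAt_target_mem_nhds (I := 𝓘(ℝ, E)) x
    exact h3.and ((h2.eventually hP).and
      (h2.eventually (Filter.eventually_all.2 hs)))
  obtain ⟨ε, hε, hball⟩ := Metric.eventually_nhds_iff_ball.1 h1
  have h2 : ∀ᶠ y in 𝓝 x, φ y ∈ Metric.ball (φ x) ε :=
    (continuousAt_extChartAt x).eventually (Metric.ball_mem_nhds _ hε)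
  filter_upwards [h2, extChartAt_source_mem_nhds (I := 𝓘(ℝ, E)) x] with y hy hys
  -- Near `x` the frame consists of coordinate fields, so the velocity has the constant components
  -- of φ y - φ x.
  refine ⟨fun t => φ.symm (φ x + t • (φ y - φ x)), (Module.finBasis ℝ E).repr (φ y - φ x),
    ?_, ?_, fun t ht => ?_⟩
  · simp [hφ]
  · simpa using φ.left_inv hys
  have h3 : φ x + t • (φ y - φ x) ∈ Metric.ball (φ x) ε := by
    rw [mem_ball_iff_norm] at hy ⊢
    rw [add_sub_cancel_left, norm_smul, Real.norm_eq_abs, abs_of_nonneg ht.1]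
    exact (mul_le_of_le_one_left (norm_nonneg _) ht.2).trans_lt hy
  obtain ⟨h4, h5, h6⟩ := hball _ h3
  refine ⟨h5, fun f hf => ?_⟩
  have h7 := hasDerivAt_comp_radial h4 hf
  refine h7.congr_deriv ?_
  have h8 : ∀ (q : M) (w : E), (∀ i, e i q
      = (trivializationAt E (TangentSpace 𝓘(ℝ, E)) x).symmL ℝ q (Module.finBasis ℝ E i)) →
      mvfderiv 𝓘(ℝ, E) f q ((trivializationAt E (TangentSpace 𝓘(ℝ, E)) x).symmL ℝ q w)
        = ∑ l, (Module.finBasis ℝ E).repr w l * mvfderiv 𝓘(ℝ, E) f q (e l q) := fun q w hq => by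
    conv_lhs => rw [← (Module.finBasis ℝ E).sum_repr w]
    rw [map_sum, map_sum]
    refine Finset.sum_congr rfl fun l _ => ?_
    rw [map_smul, map_smul, hq l, smul_eq_mul]
  exact h8 _ _ h6

/-- On a connected manifold, functions with zero derivative are constant. -/
theorem exists_eq_const_of_mvfderiv_eq_zero [T2Space M] [ConnectedSpace M] {f : M → ℝ}
    (hf : ∀ x, MDifferentiableAt 𝓘(ℝ, E) 𝓘(ℝ, ℝ) f x)
    (h : ∀ x u, mvfderiv 𝓘(ℝ, E) f x u = 0) : ∃ c, ∀ x, f x = c := by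
  have h1 : IsLocallyConstant f := by
    refine (IsLocallyConstant.iff_eventually_eq f).2 fun x => ?_
    obtain ⟨e, -, -, -, H⟩ := exists_radial_frame (E := E) x
    filter_upwards [H (fun _ => True) (Filter.Eventually.of_forall fun _ => trivial)] with y hy
    obtain ⟨γ, v, rfl, rfl, hγ⟩ := hy
    have h2 : ∀ t ∈ Set.Icc (0 : ℝ) 1, HasDerivAt (fun s => f (γ s)) 0 t := fun t ht => by
      simpa [h] using (hγ t ht).2 f (hf _)
    refine (constant_of_has_deriv_right_zero (f := fun s => f (γ s))
      (fun t ht => (h2 t ht).continuousAt.continuousWithinAt)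
      (fun t ht => (h2 t (Set.Ico_subset_Icc_self ht)).hasDerivWithinAt) 1 (by simp))
  exact ⟨f (Classical.arbitrary M), fun x => h1.apply_eq_of_preconnectedSpace _ _⟩

end Radial

section LinearEquation

/-! ### Commutator equations -/

variable {𝔸 : Type*} [NormedRing 𝔸] [NormedAlgebra ℝ 𝔸] [CompleteSpace 𝔸]

/-- The hypothesis `ha` is the equation of a parallel endomorphism along a curve. The quantity S =
a(a + L)⁻¹L = L - L(a + L)⁻¹L solves a homogeneous linear equation, so uniqueness keeps it zero; no
parallel transport has to be constructed. -/
theorem mul_inverse_mul_eq_zero_of_commutator {a θ : ℝ → 𝔸} {L : 𝔸}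
    (hθ : ContinuousOn θ (Set.Icc 0 1))
    (ha : ∀ t ∈ Set.Icc (0 : ℝ) 1, HasDerivAt a (a t * θ t - θ t * a t) t)
    (hu : ∀ t ∈ Set.Icc (0 : ℝ) 1, IsUnit (a t + L))
    (h0 : a 0 * Ring.inverse (a 0 + L) * L = 0) : a 1 * Ring.inverse (a 1 + L) * L = 0 := by
  set I : ℝ → 𝔸 := fun t => Ring.inverse (a t + L) with hI
  have hI1 : ∀ t ∈ Set.Icc (0 : ℝ) 1, (a t + L) * I t = 1 := fun t ht =>
    Ring.mul_inverse_cancel _ (hu t ht)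
  have hI2 : ∀ t ∈ Set.Icc (0 : ℝ) 1, I t * (a t + L) = 1 := fun t ht =>
    Ring.inverse_mul_cancel _ (hu t ht)
  have hId : ∀ t ∈ Set.Icc (0 : ℝ) 1,
      HasDerivAt I (-(I t * (a t * θ t - θ t * a t) * I t)) t := fun t ht => by
    obtain ⟨u, hu⟩ := hu t ht
    have h1 : HasFDerivAt Ring.inverse _ (a t + L) := hu ▸ hasFDerivAt_ringInverse (𝕜 := ℝ) u
    have h2 := h1.comp_hasDerivAt t ((ha t ht).add_const L)
    have : (↑u⁻¹ : 𝔸) = I t := by simp [hI, ← hu]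
    exact h2.congr_deriv (by simp [this])
  set S : ℝ → 𝔸 := fun t => L - L * I t * L with hS
  have key : ∀ t ∈ Set.Icc (0 : ℝ) 1, S t = a t * I t * L := fun t ht => by
    have h1 : a t * I t = 1 - L * I t := by
      rw [eq_sub_iff_add_eq, ← add_mul, hI1 t ht]
    rw [hS, h1, sub_mul, one_mul]
  have hSd : ∀ t ∈ Set.Icc (0 : ℝ) 1,
      HasDerivAt S (S t * (θ t * I t * L) - (L * I t * θ t) * S t) t := fun t ht => by
    have h1 : a t * I t = 1 - L * I t := by
      rw [eq_sub_iff_add_eq, ← add_mul, hI1 t ht]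
    have h2 : I t * a t = 1 - I t * L := by
      rw [eq_sub_iff_add_eq, ← mul_add, hI2 t ht]
    have h3 := (((hId t ht).const_mul L).mul_const L).const_sub L
    refine h3.congr_deriv (Eq.symm ?_)
    -- The relations aI = 1 - LI and Ia = 1 - IL turn the derivative -L I' L into an expression
    -- linear in `S`.
    calc S t * (θ t * I t * L) - (L * I t * θ t) * S t
        = L * (1 - I t * L) * θ t * I t * L - L * I t * θ t * (1 - L * I t) * L := by
          simp only [hS]; noncomm_ring
      _ = L * (I t * a t) * θ t * I t * L - L * I t * θ t * (a t * I t) * L := by rw [h1, h2]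
      _ = -(L * -(I t * (a t * θ t - θ t * a t) * I t) * L) := by noncomm_ring
  have hSc : ContinuousOn S (Set.Icc 0 1) := fun t ht =>
    (hSd t ht).continuousAt.continuousWithinAt
  have hIc : ContinuousOn I (Set.Icc 0 1) := fun t ht =>
    (hId t ht).continuousAt.continuousWithinAt
  obtain ⟨C₁, hC₁⟩ := isCompact_Icc.exists_bound_of_continuousOn
    ((hθ.mul hIc).mul (continuousOn_const (c := L)))
  obtain ⟨C₂, hC₂⟩ := isCompact_Icc.exists_bound_of_continuousOn
    (((continuousOn_const (c := L)).mul hIc).mul hθ)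
  -- Gronwall's inequality, with the coefficients bounded by compactness of the interval.
  have h1 := eq_zero_of_abs_deriv_le_mul_abs_self_of_eq_zero_right (K := C₁ + C₂) hSc
    (fun t ht => (hSd t (Set.Ico_subset_Icc_self ht)).hasDerivWithinAt)
    ((key 0 (by simp)).trans h0) (fun t ht => by
      have ht' := Set.Ico_subset_Icc_self ht
      calc ‖S t * (θ t * I t * L) - (L * I t * θ t) * S t‖
          ≤ ‖S t‖ * ‖θ t * I t * L‖ + ‖L * I t * θ t‖ * ‖S t‖ :=
            (norm_sub_le _ _).trans (add_le_add (norm_mul_le _ _) (norm_mul_le _ _))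
        _ ≤ ‖S t‖ * C₁ + C₂ * ‖S t‖ := by
            gcongr
            · exact hC₁ t ht'
            · exact hC₂ t ht'
        _ = (C₁ + C₂) * ‖S t‖ := by ring)
  exact (key 1 (by simp)).symm.trans (h1 1 (by simp))

end LinearEquation

/-! ### Complementing an endomorphism to an invertible one. -/

section LinearAlgebra

variable {K V : Type*} [Field K] [AddCommGroup V] [Module K V] [FiniteDimensional K V]

/-- L kills a complement of ker A and maps ker A isomorphically onto a complement of im A. Then U =
(A + L)⁻¹ sends im L back into ker A, which is the condition AUL = 0. -/
theorem exists_isUnit_add (A : Module.End K V) : ∃ L : Module.End K V, IsUnit (A + L) ∧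
    ∀ U : Module.End K V, U * (A + L) = 1 → A * U * L = 0 := by
  obtain ⟨W, hW⟩ := Submodule.exists_isCompl (LinearMap.ker A)
  obtain ⟨C, hC⟩ := Submodule.exists_isCompl (LinearMap.range A)
  have hrank : Module.finrank K (LinearMap.ker A) = Module.finrank K C := by
    have h1 := A.finrank_range_add_finrank_ker
    have h2 := Submodule.finrank_add_eq_of_isCompl hC
    omega
  let f : LinearMap.ker A ≃ₗ[K] C := LinearEquiv.ofFinrankEq _ _ hrank
  let p : V →ₗ[K] LinearMap.ker A := Submodule.projectionOnto _ _ hW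
  have hp : ∀ v : LinearMap.ker A, p v = v := Submodule.projectionOnto_apply_left hW
  let L : Module.End K V := C.subtype ∘ₗ f.toLinearMap ∘ₗ p
  have hL : ∀ v, L v = f (p v) := fun v => rfl
  refine ⟨L, ?_, fun U hU => LinearMap.ext fun v => ?_⟩
  · rw [LinearMap.isUnit_iff_ker_eq_bot, LinearMap.ker_eq_bot']
    intro v hv
    have h1 : A v = -L v := eq_neg_of_add_eq_zero_left hv
    have h2 : A v ∈ LinearMap.range A ⊓ C :=
      ⟨⟨v, rfl⟩, h1 ▸ C.neg_mem (f (p v)).2⟩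
    rw [hC.inf_eq_bot, Submodule.mem_bot] at h2
    rw [h2, zero_eq_neg, hL, Submodule.coe_eq_zero, LinearEquiv.map_eq_zero_iff] at h1
    have h3 := hp ⟨v, h2⟩
    rw [h1] at h3
    exact (congrArg Subtype.val h3).symm
  · have h1 : (A + L) (p v) = L v := by
      rw [LinearMap.add_apply, LinearMap.mem_ker.1 (p v).2, zero_add, hL, hL, hp]
    have h2 : U (L v) = p v := by
      rw [← h1]
      exact congrArg (fun F : Module.End K V => F (p v)) hU
    change A (U (L v)) = 0
    rw [h2]
    exact LinearMap.mem_ker.1 (p v).2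

theorem ker_eq_map_range {A L U : Module.End K V} (h1 : U * (A + L) = 1) (h3 : A * U * L = 0) :
    LinearMap.ker A = (LinearMap.range L).map U := by
  ext v
  rw [LinearMap.mem_ker, Submodule.mem_map]
  constructor
  · intro hv
    refine ⟨L v, ⟨v, rfl⟩, ?_⟩
    have := congrArg (fun F : Module.End K V => F v) h1
    simpa [hv] using this
  · rintro ⟨_, ⟨w, rfl⟩, rfl⟩
    exact congrArg (fun F : Module.End K V => F w) h3

/-- Both AUL and LUA equal L - LUL, so LUA = 0 as well: U maps im A into ker L. -/
theorem range_eq_map_ker {A L U : Module.End K V} (h1 : U * (A + L) = 1) (h2 : (A + L) * U = 1)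
    (h3 : A * U * L = 0) : LinearMap.range A = (LinearMap.ker L).map (A + L) := by
  have h4 : L * U * A = 0 := by
    have e1 : A * U = 1 - L * U := by rw [eq_sub_iff_add_eq, ← add_mul, h2]
    have e2 : U * A = 1 - U * L := by rw [eq_sub_iff_add_eq, ← mul_add, h1]
    rw [mul_assoc, e2]
    rw [e1] at h3
    rw [← h3]
    noncomm_ring
  ext v
  rw [LinearMap.mem_range, Submodule.mem_map]
  constructor
  · rintro ⟨w, rfl⟩
    exact ⟨U (A w), congrArg (fun F : Module.End K V => F w) h4,
      congrArg (fun F : Module.End K V => F (A w)) h2⟩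
  · rintro ⟨w, hw, rfl⟩
    exact ⟨w, by simp [LinearMap.mem_ker.1 hw]⟩

end LinearAlgebra

/-! ### The commutator equation for matrices, entry by entry. -/

section MatrixCurves

attribute [local instance] Matrix.linftyOpNormedRing Matrix.linftyOpNormedAlgebra

variable {ι : Type*} [Fintype ι] [DecidableEq ι]

theorem hasDerivAt_matrix {a : ℝ → Matrix ι ι ℝ} {a' : Matrix ι ι ℝ} {t : ℝ}
    (h : ∀ i j, HasDerivAt (fun s => a s i j) (a' i j) t) : HasDerivAt a a' t := by
  have h1 : ∀ b : Matrix ι ι ℝ, b = ∑ i, ∑ j, b i j • Matrix.single i j (1 : ℝ) := fun b => by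
    conv_lhs => rw [Matrix.matrix_eq_sum_single b]
    simp [Matrix.smul_single]
  rw [show a = fun s => ∑ i, ∑ j, a s i j • Matrix.single i j (1 : ℝ) from
    funext fun s => h1 (a s), h1 a']
  exact HasDerivAt.fun_sum fun i _ => HasDerivAt.fun_sum fun j _ => (h i j).smul_const _

theorem matrix_mul_inv_mul_eq_zero {a θ : ℝ → Matrix ι ι ℝ} {L : Matrix ι ι ℝ}
    (hθ : ∀ t ∈ Set.Icc (0 : ℝ) 1, ∀ i j, DifferentiableAt ℝ (fun s => θ s i j) t)
    (ha : ∀ t ∈ Set.Icc (0 : ℝ) 1, ∀ i j,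
      HasDerivAt (fun s => a s i j) ((a t * θ t - θ t * a t) i j) t)
    (hu : ∀ t ∈ Set.Icc (0 : ℝ) 1, IsUnit (a t + L)) (h0 : a 0 * (a 0 + L)⁻¹ * L = 0) :
    a 1 * (a 1 + L)⁻¹ * L = 0 := by
  rw [Matrix.nonsing_inv_eq_ringInverse] at h0 ⊢
  refine mul_inverse_mul_eq_zero_of_commutator (θ := θ) (fun t ht => ?_)
    (fun t ht => hasDerivAt_matrix (ha t ht)) hu h0
  have h1 : HasDerivAt θ (Matrix.of fun i j => deriv (fun s => θ s i j) t) t :=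
    hasDerivAt_matrix fun i j => (hθ t ht i j).hasDerivAt
  exact h1.continuousAt.continuousWithinAt

end MatrixCurves

/-! ### Parallel endomorphisms in local frames. -/

section ParallelEnd

variable {E : Type*} [NormedAddCommGroup E] [NormedSpace ℝ E] [FiniteDimensional ℝ E]
  {M : Type*} [TopologicalSpace M] [ChartedSpace E M]
  [IsManifold 𝓘(ℝ, E) ∞ M] [T2Space M]

theorem cov_sum (cov : Conn E M) {ι : Type*} {s : Finset ι} {X : ι → VField E M}
    (hX : ∀ i ∈ s, SmoothV (X i)) (x : M) :
    cov (fun y => ∑ i ∈ s, X i y) x = ∑ i ∈ s, cov (X i) x := by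
  classical
  induction s using Finset.induction_on with
  | empty => simpa using cov_zero cov x
  | insert i s hi ih =>
    have h1 : ∀ j ∈ s, SmoothV (X j) := fun j hj => hX j (Finset.mem_insert_of_mem hj)
    simp only [Finset.sum_insert hi]
    rw [cov_add cov (hX i (Finset.mem_insert_self i s)) (SmoothV.sum h1), ih h1]

/-- Differentiating A e_j = Σ a_ij e_i along e_l and comparing components with A(∇e_j) gives da = aΓ
- Γa. -/
theorem mvfderiv_matrix_of_parallelEnd {cov : Conn E M} {A : EndField E M}
    (hp : IsParallelEnd cov A) {ι : Type*} [Fintype ι] [DecidableEq ι] {e : ι → VField E M}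
    (he : ∀ i, SmoothV (e i)) {a : M → Matrix ι ι ℝ}
    (ha : ∀ i j, ContMDiff 𝓘(ℝ, E) 𝓘(ℝ, ℝ) ∞ fun y => a y i j) {Γ : Matrix ι ι ℝ} {y : M}
    {b : Module.Basis ι ℝ (TangentSpace 𝓘(ℝ, E) y)} (hb : ∀ i, b i = e i y)
    (hae : ∀ j, ∀ᶠ z in 𝓝 y, A z (e j z) = ∑ i, a z i j • e i z) (l : ι)
    (hΓ : ∀ j, cov (e j) y (e l y) = ∑ i, Γ i j • e i y) (i j : ι) :
    mvfderiv 𝓘(ℝ, E) (fun z => a z i j) y (e l y) = (a y * Γ - Γ * a y) i j := by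
  have h1 := hp (e l) (e j) (he l) (he j) y
  have hs : ∀ k, SmoothV fun z => a z k j • e k z := fun k => (he k).smul (ha k j)
  rw [cov_congr cov ((SmoothV.sum fun k _ => hs k).mdifferentiableAt y) (hae j),
    cov_sum cov (fun k _ => hs k), hΓ, map_sum, sum_apply] at h1
  simp only [cov_smul cov (ha _ _) (he _), map_smul, (hae _).self_of_nhds, hΓ] at h1
  have h2 := congrArg (fun v => b.repr v i) h1
  simp only [← hb, map_sum, map_add, map_smul, Finsupp.coe_finsetSum, Finset.sum_apply,
    Finsupp.add_apply, Finsupp.smul_apply, smul_eq_mul, b.repr_self,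
    Finsupp.single_apply, mul_ite, mul_one, mul_zero, Finset.sum_ite_eq', Finset.mem_univ,
    if_true, Finset.sum_add_distrib] at h2
  rw [Matrix.sub_apply, Matrix.mul_apply, Matrix.mul_apply, eq_sub_iff_add_eq, ← hb,
    ← Finset.sum_congr rfl fun k _ => mul_comm (a y k j) (Γ i k), add_comm, h2]
  exact Finset.sum_congr rfl fun k _ => mul_comm _ _

/-- In suitable frames, parallel endomorphisms have constant rank. -/
theorem exists_frame_of_parallelEnd {cov : Conn E M} [CompleteSpace E]
    (hcov : CovariantDerivative.ContMDiffCovariantDerivative cov ∞) {A : EndField E M}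
    (hA : SmoothEnd A) (hp : IsParallelEnd cov A) (x : M) :
    ∃ (e : Fin (Module.finrank ℝ E) → VField E M)
      (a : M → Matrix (Fin (Module.finrank ℝ E)) (Fin (Module.finrank ℝ E)) ℝ)
      (L : Matrix (Fin (Module.finrank ℝ E)) (Fin (Module.finrank ℝ E)) ℝ),
      (∀ i, SmoothV (e i)) ∧ (∀ i j, ContMDiff 𝓘(ℝ, E) 𝓘(ℝ, ℝ) ∞ fun y => a y i j) ∧
      (∀ X : VField E M, SmoothV X → ∃ c : Fin (Module.finrank ℝ E) → M → ℝ,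
        (∀ i, ContMDiff 𝓘(ℝ, E) 𝓘(ℝ, ℝ) ∞ (c i)) ∧ (∀ᶠ y in 𝓝 x, X y = ∑ i, c i y • e i y)) ∧
      ∀ᶠ y in 𝓝 x, (∃ b : Module.Basis (Fin (Module.finrank ℝ E)) ℝ (TangentSpace 𝓘(ℝ, E) y),
        (∀ i, b i = e i y) ∧ Matrix.toLin b b (a y) = A y) ∧
        IsUnit (a y + L) ∧ a y * (a y + L)⁻¹ * L = 0 := by
  obtain ⟨e, he, hb, hc, hpath⟩ := exists_radial_frame (E := E) x
  choose a ha hae using fun j => hc _ (hA _ (he j))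
  choose Γ hΓ hΓe using fun l j => hc _ ((he l).cov hcov (he j))
  set a' : M → Matrix (Fin (Module.finrank ℝ E)) (Fin (Module.finrank ℝ E)) ℝ :=
    fun y => Matrix.of fun i j => a j i y with ha'
  -- L is adapted to the matrix at `x` only and kept constant; the relation at nearby points comes
  -- from the commutator equation along segments.
  obtain ⟨L₀, hL₀, hL₀'⟩ := exists_isUnit_add (Matrix.toLinAlgEquiv' (a' x))
  set L := Matrix.toLinAlgEquiv'.symm L₀ with hL
  have hunit : IsUnit (a' x + L) := by
    have := hL₀.map (Matrix.toLinAlgEquiv' (R := ℝ)).symm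
    rwa [map_add, AlgEquiv.symm_apply_apply] at this
  have hx : a' x * (a' x + L)⁻¹ * L = 0 := by
    apply (Matrix.toLinAlgEquiv' (R := ℝ)).injective
    rw [map_zero, map_mul, map_mul, hL, AlgEquiv.apply_symm_apply]
    refine hL₀' _ ?_
    have h1 := congrArg (Matrix.toLinAlgEquiv' (R := ℝ))
      (Matrix.nonsing_inv_mul _ ((Matrix.isUnit_iff_isUnit_det _).1 hunit))
    rwa [map_mul, map_add, map_one, hL, AlgEquiv.apply_symm_apply] at h1
  have hu : ∀ᶠ y in 𝓝 x, IsUnit (a' y + L) := by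
    have h1 : ContMDiffAt 𝓘(ℝ, E) 𝓘(ℝ, ℝ) ∞ (fun y => (a' y + L).det) x :=
      contMDiffAt_det fun i j => ((ha j i) x).add contMDiffAt_const
    have h2 := h1.continuousAt.eventually_ne
      (isUnit_iff_ne_zero.1 ((Matrix.isUnit_iff_isUnit_det _).1 hunit))
    filter_upwards [h2] with y hy
    exact (Matrix.isUnit_iff_isUnit_det _).2 (isUnit_iff_ne_zero.2 hy)
  have hd : ∀ᶠ y in 𝓝 x, ∀ l i j, mvfderiv 𝓘(ℝ, E) (fun z => a' z i j) y (e l y)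
      = (a' y * (Matrix.of fun i j => Γ l j i y) - (Matrix.of fun i j => Γ l j i y) * a' y) i j := by
    filter_upwards [hb, (Filter.eventually_all.2 hae).eventually_nhds,
      Filter.eventually_all.2 fun l => Filter.eventually_all.2 (hΓe l)] with y hb hae hΓe l i j
    obtain ⟨b, hb⟩ := hb
    exact mvfderiv_matrix_of_parallelEnd hp he (a := a') (fun i j => ha j i) hb
      (fun j => hae.mono fun z hz => hz j) l (fun j => hΓe l j) i j
  refine ⟨e, a', L, he, fun i j => ha j i, hc, ?_⟩
  filter_upwards [hb, Filter.eventually_all.2 hae, hu, hpath _ (hu.and hd)] with y hb hae hu hpath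
  refine ⟨?_, hu, ?_⟩
  · obtain ⟨b, hb⟩ := hb
    refine ⟨b, hb, b.ext fun j => ?_⟩
    rw [Matrix.toLin_self, hb j, hae j]
    exact Finset.sum_congr rfl fun i _ => by rw [hb i]; rfl
  · obtain ⟨γ, v, rfl, rfl, hγ⟩ := hpath
    have hdiff : ∀ t ∈ Set.Icc (0 : ℝ) 1, ∀ l i j,
        DifferentiableAt ℝ (fun s => Γ l j i (γ s)) t := fun t ht l i j =>
      ((hγ t ht).2 _ (((hΓ l j i) _).mdifferentiableAt (by simp))).differentiableAt
    refine matrix_mul_inv_mul_eq_zero (a := fun t => a' (γ t))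
      (θ := fun t => Matrix.of fun i j => ∑ l, v l * Γ l j i (γ t))
      (fun t ht i j => ?_) (fun t ht i j => ?_) (fun t ht => (hγ t ht).1.1) hx
    · simp only [Matrix.of_apply]
      exact DifferentiableAt.fun_sum fun l _ => (hdiff t ht l i j).const_mul _
    · have h1 := (hγ t ht).2 (fun z => a' z i j) (((ha j i) _).mdifferentiableAt (by simp))
      refine h1.congr_deriv ?_
      simp only [(hγ t ht).1.2, Matrix.sub_apply, Matrix.mul_apply, Matrix.of_apply, Finset.mul_sum,
        Finset.sum_mul, mul_sub, Finset.sum_sub_distrib]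
      congr 1
      · rw [Finset.sum_comm]
        exact Finset.sum_congr rfl fun _ _ => Finset.sum_congr rfl fun _ _ => by ring
      · rw [Finset.sum_comm]
        exact Finset.sum_congr rfl fun _ _ => Finset.sum_congr rfl fun _ _ => by ring

end ParallelEnd

/-! ### Image and kernel of a parallel endomorphism as smooth subbundles. -/

section Subbundles

variable {E : Type*} [NormedAddCommGroup E] [NormedSpace ℝ E] [FiniteDimensional ℝ E]
  {M : Type*} [TopologicalSpace M] [ChartedSpace E M]
  [IsManifold 𝓘(ℝ, E) ∞ M] [T2Space M]

/-- The rank may at first depend on the point; local frames make it locally constant, and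
connectedness makes it constant. -/
theorem isSubbundle_of_forall [ConnectedSpace M] {D : Distribution E M}
    (h : ∀ x, ∃ (k : ℕ) (s : Fin k → VField E M), (∀ i, SmoothV (s i)) ∧
      ∀ᶠ y in 𝓝 x, LinearIndependent ℝ (fun i => s i y) ∧
        Submodule.span ℝ (Set.range fun i => s i y) = D y) : IsSubbundle D := by
  have h1 : ∀ {k : ℕ} {s : Fin k → VField E M} {y : M}, LinearIndependent ℝ (fun i => s i y) ∧
      Submodule.span ℝ (Set.range fun i => s i y) = D y → Module.finrank ℝ (D y) = k :=
    fun {k s y} hy => by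
      rw [← hy.2, finrank_span_eq_card hy.1, Fintype.card_fin]
  have h2 : IsLocallyConstant fun y => Module.finrank ℝ (D y) := by
    refine (IsLocallyConstant.iff_eventually_eq _).2 fun x => ?_
    obtain ⟨k, s, -, hs⟩ := h x
    filter_upwards [hs] with y hy
    rw [h1 hy, h1 hs.self_of_nhds]
  refine ⟨Module.finrank ℝ (D (Classical.arbitrary M)), fun x => ?_⟩
  obtain ⟨k, s, hs, hsy⟩ := h x
  obtain rfl : k = Module.finrank ℝ (D (Classical.arbitrary M)) := by
    rw [h2.apply_eq_of_preconnectedSpace (Classical.arbitrary M) x]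
    exact (h1 hsy.self_of_nhds).symm
  exact ⟨s, hs, hsy⟩

theorem exists_spanning_of_coordinates {D : Distribution E M} {x : M} {ι : Type*} [Fintype ι]
    {e : ι → VField E M} (he : ∀ i, SmoothV (e i)) {k : ℕ} {c : Fin k → M → ι → ℝ}
    (hc : ∀ᶠ y in 𝓝 x, ∀ j i, ContMDiffAt 𝓘(ℝ, E) 𝓘(ℝ, ℝ) ∞ (fun z => c j z i) y)
    (h : ∀ᶠ y in 𝓝 x, LinearIndependent ℝ (fun j => c j y) ∧
      ∃ b : Module.Basis ι ℝ (TangentSpace 𝓘(ℝ, E) y), (∀ i, b i = e i y) ∧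
        (Submodule.span ℝ (Set.range fun j => c j y)).map b.equivFun.symm.toLinearMap = D y) :
    ∃ (k : ℕ) (s : Fin k → VField E M), (∀ i, SmoothV (s i)) ∧
      ∀ᶠ y in 𝓝 x, LinearIndependent ℝ (fun i => s i y) ∧
        Submodule.span ℝ (Set.range fun i => s i y) = D y := by
  choose g hg hgc using fun j i => exists_smooth_eventuallyEq (f := fun z => c j z i) hc
    fun y hy => hy j i
  refine ⟨k, fun j y => ∑ i, g j i y • e i y, fun j => SmoothV.sum fun i _ => (he i).smul (hg j i),
    ?_⟩
  filter_upwards [h, Filter.eventually_all.2 fun j => Filter.eventually_all.2 (hgc j)] with y hy hgc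
  obtain ⟨hli, b, hb, hD⟩ := hy
  have h1 : (fun j => ∑ i, g j i y • e i y) = b.equivFun.symm ∘ fun j => c j y := by
    funext j
    rw [Function.comp_apply, b.equivFun_symm_apply]
    exact Finset.sum_congr rfl fun i _ => by rw [hgc j i, hb i]
  rw [h1]
  refine ⟨hli.map' b.equivFun.symm.toLinearMap (LinearEquiv.ker _), ?_⟩
  rw [← hD, Submodule.map_span, ← Set.range_comp]
  rfl

theorem map_equivFun_symm_range {ι V : Type*} [Fintype ι] [DecidableEq ι] [AddCommGroup V]
    [Module ℝ V] (b : Module.Basis ι ℝ V) (a : Matrix ι ι ℝ) :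
    (LinearMap.range (Matrix.toLin' a)).map b.equivFun.symm.toLinearMap
      = LinearMap.range (Matrix.toLin b b a) := by
  have h1 : Matrix.toLin b b a ∘ₗ b.equivFun.symm.toLinearMap
      = b.equivFun.symm.toLinearMap ∘ₗ Matrix.toLin' a := by
    ext j
    simp [Matrix.toLin_self, b.equivFun_symm_apply]
  rw [← LinearMap.range_comp, ← h1]
  exact LinearMap.range_comp_of_range_eq_top _ (LinearEquiv.range _)

theorem map_equivFun_symm_ker {ι V : Type*} [Fintype ι] [DecidableEq ι] [AddCommGroup V]
    [Module ℝ V] (b : Module.Basis ι ℝ V) (a : Matrix ι ι ℝ) :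
    (LinearMap.ker (Matrix.toLin' a)).map b.equivFun.symm.toLinearMap
      = LinearMap.ker (Matrix.toLin b b a) := by
  have h1 : Matrix.toLin b b a ∘ₗ b.equivFun.symm.toLinearMap
      = b.equivFun.symm.toLinearMap ∘ₗ Matrix.toLin' a := by
    ext j
    simp [Matrix.toLin_self, b.equivFun_symm_apply]
  ext v
  obtain ⟨w, rfl⟩ := b.equivFun.symm.surjective v
  have h2 : Matrix.toLin b b a (b.equivFun.symm w) = b.equivFun.symm (Matrix.toLin' a w) :=
    congrArg (fun F : (ι → ℝ) →ₗ[ℝ] V => F w) h1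
  rw [LinearMap.mem_ker, h2, LinearEquiv.map_eq_zero_iff]
  constructor
  · rintro ⟨u, hu, hu'⟩
    rw [← b.equivFun.symm.injective hu']
    exact hu
  · exact fun hw => ⟨w, hw, rfl⟩

variable [CompleteSpace E] {cov : Conn E M} {A : EndField E M}

theorem isSubbundle_of_parallelEnd [ConnectedSpace M]
    (hcov : CovariantDerivative.ContMDiffCovariantDerivative cov ∞)
    (hA : SmoothEnd A) (hp : IsParallelEnd cov A) :
    IsSubbundle (fun x => LinearMap.range (A x)) ∧ IsSubbundle (fun x => LinearMap.ker (A x)) := by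
  constructor <;> refine isSubbundle_of_forall fun x => ?_ <;>
  obtain ⟨e, a, L, he, ha, -, h⟩ := exists_frame_of_parallelEnd hcov hA hp x
  · let w := Module.finBasis ℝ (LinearMap.ker (Matrix.toLin' L))
    have hw : LinearIndependent ℝ (fun j => (w j : Fin (Module.finrank ℝ E) → ℝ)) :=
      w.linearIndependent.map' (Submodule.subtype _) (Submodule.ker_subtype _)
    have hws : Submodule.span ℝ (Set.range fun j => (w j : Fin (Module.finrank ℝ E) → ℝ))
        = LinearMap.ker (Matrix.toLin' L) := by
      have := congrArg (Submodule.map (Submodule.subtype _)) w.span_eq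
      rwa [Submodule.map_span, ← Set.range_comp, Submodule.map_top, Submodule.range_subtype] at this
    -- im A = (A + L)(ker L), so a fixed basis of ker L is moved by a smooth invertible matrix.
    refine exists_spanning_of_coordinates he (c := fun j y => Matrix.toLin' (a y + L) (w j))
      (Filter.Eventually.of_forall fun y j i => ?_) ?_
    · simp only [Matrix.toLin'_apply, Matrix.mulVec, dotProduct, Matrix.add_apply]
      exact ContMDiffAt.sum fun k _ => ((ha i k y).add contMDiffAt_const).mul contMDiffAt_const
    · filter_upwards [h] with y hy
      obtain ⟨⟨b, hb, hbA⟩, hu, h0⟩ := hy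
      have hu1 := Matrix.nonsing_inv_mul _ ((Matrix.isUnit_iff_isUnit_det _).1 hu)
      have hu2 := Matrix.mul_nonsing_inv _ ((Matrix.isUnit_iff_isUnit_det _).1 hu)
      have e1 := congrArg Matrix.toLin' hu1
      have e2 := congrArg Matrix.toLin' hu2
      have e3 := congrArg Matrix.toLin' h0
      simp only [Matrix.toLin'_mul, map_add, Matrix.toLin'_one, map_zero] at e1 e2 e3
      have hr := range_eq_map_ker e1 e2 e3
      refine ⟨hw.map' (Matrix.toLin' (a y + L)) ?_, b, hb, ?_⟩
      · rw [map_add]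
        exact LinearMap.ker_eq_bot_of_inverse e1
      · change Submodule.map _ (Submodule.span ℝ (Set.range (Matrix.toLin' (a y + L) ∘ _))) = _
        rw [Set.range_comp, ← Submodule.map_span, hws, map_add, ← hr, map_equivFun_symm_range, hbA]
  · let w := Module.finBasis ℝ (LinearMap.range (Matrix.toLin' L))
    have hw : LinearIndependent ℝ (fun j => (w j : Fin (Module.finrank ℝ E) → ℝ)) :=
      w.linearIndependent.map' (Submodule.subtype _) (Submodule.ker_subtype _)
    have hws : Submodule.span ℝ (Set.range fun j => (w j : Fin (Module.finrank ℝ E) → ℝ))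
        = LinearMap.range (Matrix.toLin' L) := by
      have := congrArg (Submodule.map (Submodule.subtype _)) w.span_eq
      rwa [Submodule.map_span, ← Set.range_comp, Submodule.map_top, Submodule.range_subtype] at this
    -- ker A = (A + L)⁻¹(im L), where the inverse is known to be smooth only near `x`.
    refine exists_spanning_of_coordinates he (c := fun j y => Matrix.toLin' (a y + L)⁻¹ (w j)) ?_ ?_
    · filter_upwards [h] with y hy j i
      simp only [Matrix.toLin'_apply, Matrix.mulVec, dotProduct]
      refine ContMDiffAt.sum fun k _ => ContMDiffAt.mul ?_ contMDiffAt_const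
      exact contMDiffAt_inv (fun i j => (ha i j y).add contMDiffAt_const)
        (isUnit_iff_ne_zero.1 ((Matrix.isUnit_iff_isUnit_det _).1 hy.2.1)) i k
    · filter_upwards [h] with y hy
      obtain ⟨⟨b, hb, hbA⟩, hu, h0⟩ := hy
      have hu1 := Matrix.nonsing_inv_mul _ ((Matrix.isUnit_iff_isUnit_det _).1 hu)
      have hu2 := Matrix.mul_nonsing_inv _ ((Matrix.isUnit_iff_isUnit_det _).1 hu)
      have e1 := congrArg Matrix.toLin' hu1
      have e2 := congrArg Matrix.toLin' hu2
      have e3 := congrArg Matrix.toLin' h0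
      simp only [Matrix.toLin'_mul, map_add, Matrix.toLin'_one, map_zero] at e1 e2 e3
      have hr := ker_eq_map_range e1 e3
      refine ⟨hw.map' (Matrix.toLin' (a y + L)⁻¹) (LinearMap.ker_eq_bot_of_inverse e2), b, hb, ?_⟩
      change Submodule.map _ (Submodule.span ℝ (Set.range (Matrix.toLin' (a y + L)⁻¹ ∘ _))) = _
      rw [Set.range_comp, ← Submodule.map_span, hws, ← hr, map_equivFun_symm_ker, hbA]

/-- Local primitives: smooth sections of the image of a parallel endomorphism are locally
images of smooth vector fields. -/
theorem exists_apply_eventuallyEq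
    (hcov : CovariantDerivative.ContMDiffCovariantDerivative cov ∞)
    (hA : SmoothEnd A) (hp : IsParallelEnd cov A) {Y : VField E M}
    (hY : IsSection (fun x => LinearMap.range (A x)) Y) (x : M) :
    ∃ Z : VField E M, SmoothV Z ∧ ∀ᶠ y in 𝓝 x, Y y = A y (Z y) := by
  obtain ⟨e, a, L, he, ha, hc, h⟩ := exists_frame_of_parallelEnd hcov hA hp x
  obtain ⟨c, hcs, hYc⟩ := hc Y hY.1
  have h1 : ∀ᶠ y in 𝓝 x, ∀ i, ContMDiffAt 𝓘(ℝ, E) 𝓘(ℝ, ℝ) ∞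
      (fun z => ((a z + L)⁻¹.mulVec fun k => c k z) i) y := by
    filter_upwards [h] with y hy i
    simp only [Matrix.mulVec, dotProduct]
    refine ContMDiffAt.sum fun k _ => ContMDiffAt.mul ?_ (hcs k y)
    exact contMDiffAt_inv (fun i j => (ha i j y).add contMDiffAt_const)
      (isUnit_iff_ne_zero.1 ((Matrix.isUnit_iff_isUnit_det _).1 hy.2.1)) i k
  choose g hg hgc using fun i => exists_smooth_eventuallyEq h1 fun y hy => hy i
  refine ⟨fun y => ∑ i, g i y • e i y, SmoothV.sum fun i _ => (he i).smul (hg i), ?_⟩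
  filter_upwards [h, hYc, Filter.eventually_all.2 hgc] with y hy hYc hgc
  obtain ⟨⟨b, hb, hbA⟩, hu, h0⟩ := hy
  have hu1 := Matrix.nonsing_inv_mul _ ((Matrix.isUnit_iff_isUnit_det _).1 hu)
  -- Since a(a + L)⁻¹L = 0, the matrix (a + L)⁻¹ is a generalized inverse of `a`; applied to a
  -- section of the image it gives a smooth preimage.
  have h2 : a y * (a y + L)⁻¹ * a y = a y := by
    have h3 : a y * ((a y + L)⁻¹ * (a y + L)) = a y := by rw [hu1, mul_one]
    rwa [mul_add, mul_add, ← mul_assoc, ← mul_assoc, h0, add_zero] at h3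
  have h3 : ∑ i, g i y • e i y
      = Matrix.toLin b b (a y + L)⁻¹ (∑ i, c i y • e i y) := by
    simp only [← hb, hgc, ← b.equivFun_symm_apply]
    apply b.equivFun.injective
    rw [LinearEquiv.apply_symm_apply]
    funext i
    rw [b.equivFun_apply, ← LinearMap.toMatrix_mulVec_repr b b, LinearMap.toMatrix_toLin,
      ← b.equivFun_apply, LinearEquiv.apply_symm_apply]
  obtain ⟨w, hw⟩ := hY.2 y
  rw [h3, ← hYc, ← hw, ← hbA, ← LinearMap.comp_apply, ← LinearMap.comp_apply,
    ← Matrix.toLin_mul, ← Matrix.toLin_mul, h2]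

end Subbundles

/-! ### Consequences of parallelism: integrability, total geodesy, commutation with curvature. -/

section ParallelTensors

variable {E : Type*} [NormedAddCommGroup E] [NormedSpace ℝ E] [FiniteDimensional ℝ E]
  [CompleteSpace E] {M : Type*} [TopologicalSpace M] [ChartedSpace E M]
  [IsManifold 𝓘(ℝ, E) ∞ M] [T2Space M] {cov : Conn E M}

theorem SmoothForm.const_smul {T : FormField E M} (hT : SmoothForm T) (k : ℝ) :
    SmoothForm (fun x => k • T x) := fun X Y hX hY => by
  simp only [LinearMap.smul_apply, smul_eq_mul]
  exact contMDiff_const.mul (hT X Y hX hY)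

theorem SmoothEnd.const_smul {A : EndField E M} (hA : SmoothEnd A) (k : ℝ) :
    SmoothEnd (fun x => k • A x) := fun X hX => by
  simpa using (hA X hX).const_smul k

theorem IsParallelForm.const_smul {T : FormField E M} (hT : SmoothForm T)
    (h : IsParallelForm cov T) (k : ℝ) : IsParallelForm cov (fun x => k • T x) := by
  intro x u v w
  obtain ⟨V, hV, rfl⟩ := exists_smoothV_apply_eq x v
  obtain ⟨W, hW, rfl⟩ := exists_smoothV_apply_eq x w
  rw [nablaForm_eq cov (hT.const_smul k) hV hW]
  simp only [LinearMap.smul_apply, smul_eq_mul]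
  rw [mvfderiv_fun_mul mdifferentiableAt_const (hT.mdifferentiableAt hV hW x), mvfderiv_const]
  simp only [add_apply, smul_apply, smul_eq_mul, smul_zero, zero_apply]
  rw [h.mvfderiv_eq hT hV hW]
  ring

theorem IsParallelEnd.const_smul {A : EndField E M} (hA : SmoothEnd A)
    (h : IsParallelEnd cov A) (k : ℝ) : IsParallelEnd cov (fun x => k • A x) := by
  intro X Y hX hY x
  simp only [LinearMap.smul_apply]
  rw [cov_const_smul cov k (hA Y hY), smul_apply, h X Y hX hY]

/-- Writing each bracket as a difference of covariant derivatives and moving A out of them, all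
terms of the Nijenhuis tensor cancel; nothing is needed about A². -/
theorem IsParallelEnd.isIntegrableEnd {A : EndField E M} (hA : SmoothEnd A)
    (h : IsParallelEnd cov A) (htor : cov.torsion = 0) : IsIntegrableEnd A := by
  intro X Y hX hY x
  rw [bracket_eq htor (hA X hX) (hA Y hY), bracket_eq htor (hA X hX) hY,
    bracket_eq htor hX (hA Y hY), bracket_eq htor hX hY, h _ Y (hA X hX) hY, h _ X (hA Y hY) hX,
    h X Y hX hY, h Y X hY hX]
  simp only [map_sub]
  abel

theorem IsTotallyGeodesic.isIntegrable {D : Distribution E M} (h : IsTotallyGeodesic cov D)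
    (htor : cov.torsion = 0) : IsIntegrable D := fun X Y hX hY x => by
  rw [bracket_eq htor hX.1 hY.1]
  exact (D x).sub_mem (h X Y hX hY x) (h Y X hY hX x)

theorem IsParallelEnd.isTotallyGeodesic_ker {A : EndField E M} (h : IsParallelEnd cov A) :
    IsTotallyGeodesic cov (fun x => LinearMap.ker (A x)) := fun X Y hX hY x => by
  have h1 := h X Y hX.1 hY.1 x
  rw [funext fun y => LinearMap.mem_ker.1 (hY.2 y), cov_zero, zero_apply] at h1
  exact LinearMap.mem_ker.2 h1.symm

/-- With Y = AZ near `x` for a smooth Z, one has ∇_X Y = A(∇_X Z); the smooth local primitive Z is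
the point. -/
theorem IsParallelEnd.isTotallyGeodesic_range
    (hcov : CovariantDerivative.ContMDiffCovariantDerivative cov ∞) {A : EndField E M}
    (hA : SmoothEnd A) (h : IsParallelEnd cov A) :
    IsTotallyGeodesic cov (fun x => LinearMap.range (A x)) := fun X Y hX hY x => by
  obtain ⟨Z, hZ, hYZ⟩ := exists_apply_eventuallyEq hcov hA h hY x
  rw [cov_congr cov ((hA Z hZ).mdifferentiableAt x) hYZ, h X Z hX.1 hZ]
  exact ⟨_, rfl⟩

theorem IsParallelEnd.curv_apply (hcov : CovariantDerivative.ContMDiffCovariantDerivative cov ∞)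
    {A : EndField E M} (hA : SmoothEnd A) (h : IsParallelEnd cov A) (x : M)
    (u v w : TangentSpace 𝓘(ℝ, E) x) : curv cov x u v (A x w) = A x (curv cov x u v w) := by
  obtain ⟨U, hU, rfl⟩ := exists_smoothV_apply_eq x u
  obtain ⟨V, hV, rfl⟩ := exists_smoothV_apply_eq x v
  obtain ⟨W, hW, rfl⟩ := exists_smoothV_apply_eq x w
  rw [← curvOp_eq_curv hcov hU hV hW, ← curvOp_eq_curv hcov hU hV (hA W hW)]
  have h1 : ∀ {X : VField E M}, SmoothV X → (fun y => cov (fun z => A z (W z)) y (X y))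
      = fun y => A y (cov W y (X y)) := fun hX => funext fun y => h _ W hX hW y
  simp only [curvOp]
  rw [h1 hU, h1 hV, h U _ hU (hV.cov hcov hW), h V _ hV (hU.cov hcov hW),
    h _ W (hU.bracket hV) hW]
  simp only [map_sub]

end ParallelTensors

/-! ### Eigenspaces of a skew involution. -/

section LinearAlgebra

variable {V : Type*} [AddCommGroup V] [Module ℝ V] [FiniteDimensional ℝ V]

/-- Skewness makes both eigenspaces isotropic, so each has at most half the dimension; as they span,
both have exactly half. -/
theorem finrank_eigenspace_eq {Ω : LinearMap.BilinForm ℝ V} (hΩ : Ω.Nondegenerate)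
    {J : Module.End ℝ V} (hJ : ∀ u v, Ω (J u) v = -Ω u (J v)) (hJ2 : ∀ v, J (J v) = v) :
    Module.finrank ℝ (Module.End.eigenspace J 1) = Module.finrank ℝ (Module.End.eigenspace J (-1)) := by
  have h1 : ∀ c : ℝ, c ≠ 0 → 2 * Module.finrank ℝ (Module.End.eigenspace J c)
      ≤ Module.finrank ℝ V := fun c hc => by
    have h2 : Module.End.eigenspace J c ≤ Ω.orthogonal (Module.End.eigenspace J c) := by
      intro v hv
      rw [LinearMap.BilinForm.mem_orthogonal_iff]
      intro u hu
      have h3 := hJ u v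
      rw [Module.End.mem_eigenspace_iff.1 hu, Module.End.mem_eigenspace_iff.1 hv, map_smul,
        LinearMap.smul_apply, map_smul, smul_eq_mul] at h3
      have h4 : c * Ω u v = 0 := by linarith
      exact (mul_eq_zero.1 h4).resolve_left hc
    have h3 := Submodule.finrank_mono h2
    rw [LinearMap.BilinForm.finrank_orthogonal hΩ] at h3
    have h4 := Submodule.finrank_le (Module.End.eigenspace J c)
    omega
  have h2 : Module.End.eigenspace J 1 ⊔ Module.End.eigenspace J (-1) = ⊤ := by
    rw [eq_top_iff]
    intro v _
    have e : v = (1 / 2 : ℝ) • (v + J v) + (1 / 2 : ℝ) • (v - J v) := by module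
    rw [e]
    refine Submodule.add_mem_sup (Submodule.smul_mem _ _ ?_) (Submodule.smul_mem _ _ ?_)
    · rw [Module.End.mem_eigenspace_iff, map_add, hJ2]; module
    · rw [Module.End.mem_eigenspace_iff, map_sub, hJ2]; module
  have h3 := Submodule.finrank_add_le_finrank_add_finrank (Module.End.eigenspace J 1)
    (Module.End.eigenspace J (-1))
  rw [h2, finrank_top] at h3
  have h4 := h1 1 one_ne_zero
  have h5 := h1 (-1) (by norm_num)
  omega

end LinearAlgebra

/-! ### Connections with parallel Ricci tensor: the three cases for r. -/

section RicciParallel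

variable {E : Type*} [NormedAddCommGroup E] [NormedSpace ℝ E] [FiniteDimensional ℝ E]
  [CompleteSpace E] {M : Type*} [TopologicalSpace M] [ChartedSpace E M]
  [IsManifold 𝓘(ℝ, E) ∞ M] [T2Space M]

namespace IsWeylFlatSymplectic

variable {n : ℕ} {Ω : FormField E M} {cov : Conn E M}

theorem omega_apply_ricciEnd (h : IsWeylFlatSymplectic n Ω cov) (x : M)
    (u v : TangentSpace 𝓘(ℝ, E) x) : Ω x u (ricciEnd Ω cov x v) = -ricci cov x u v := by
  rw [h.skew, h.omega_ricciEnd, h.ricci_symm]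

theorem isInfSymplectic (h : IsWeylFlatSymplectic n Ω cov) :
    IsInfSymplectic Ω (ricciEnd Ω cov) := fun x u v => by
  rw [h.omega_ricciEnd, h.omega_apply_ricciEnd, add_neg_cancel]

theorem isParallelEnd (h : IsWeylFlatSymplectic n Ω cov) (hp : IsParallelForm cov (ricci cov)) :
    IsParallelEnd cov (ricciEnd Ω cov) := by
  intro X Y hX hY x
  rw [← sub_eq_zero]
  refine (h.symplectic.nondegenerate x).1 _ fun z => ?_
  obtain ⟨Z, hZ, rfl⟩ := exists_smoothV_apply_eq x z
  have h1 := h.connection.parallel.mvfderiv_eq h.symplectic.smooth (h.smoothEnd_ricciEnd Y hY) hZ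
    x (X x)
  simp only [h.omega_ricciEnd] at h1
  rw [hp.mvfderiv_eq h.smoothForm_ricci hY hZ] at h1
  rw [map_sub, LinearMap.sub_apply, h.omega_ricciEnd]
  linarith

/-- Locally the eigenvalue c of A² is the quotient Ω(A²Y,Z)/Ω(Y,Z), hence smooth. Differentiating
Ω(A²Y,Z) = c Ω(Y,Z) with A and `Ω` parallel leaves dc · Ω(Y,Z) = 0. -/
theorem exists_sq_eq [ConnectedSpace M] (h : IsWeylFlatSymplectic n Ω cov)
    (hp : IsParallelForm cov (ricci cov)) :
    ∃ r : ℝ, ∀ x u, ricciEnd Ω cov x (ricciEnd Ω cov x u) = -r • u := by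
  have hA := h.smoothEnd_ricciEnd
  have hpA := h.isParallelEnd hp
  have hc : ∀ x, ∃ c : ℝ, ∀ v, ricciEnd Ω cov x (ricciEnd Ω cov x v) = c • v := fun x =>
    exists_sq_eq_smul (h.symplectic.alt x) (h.symplectic.nondegenerate x) (h.omega_ricciEnd x)
      (h.ricci_symm x) (h.omega_curv x) (hpA.curv_apply h.connection.smooth hA x)
  choose c hc using hc
  have hloc : ∀ x, ∃ Y Z : VField E M, SmoothV Y ∧ SmoothV Z ∧ Ω x (Y x) (Z x) ≠ 0 := fun x => by
    obtain ⟨u, hu⟩ := h.exists_ne_zero x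
    obtain ⟨v, hv⟩ := h.exists_omega_ne_zero x hu
    obtain ⟨Y, hY, rfl⟩ := exists_smoothV_apply_eq x u
    obtain ⟨Z, hZ, rfl⟩ := exists_smoothV_apply_eq x v
    exact ⟨Y, Z, hY, hZ, hv⟩
  have heq : ∀ (Y Z : VField E M) y,
      Ω y (ricciEnd Ω cov y (ricciEnd Ω cov y (Y y))) (Z y) = c y * Ω y (Y y) (Z y) :=
    fun Y Z y => by rw [hc, map_smul, LinearMap.smul_apply, smul_eq_mul]
  have hd : ∀ x, MDifferentiableAt 𝓘(ℝ, E) 𝓘(ℝ, ℝ) c x := fun x => by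
    obtain ⟨Y, Z, hY, hZ, hne⟩ := hloc x
    have h1 := h.symplectic.smooth Y Z hY hZ x
    have h2 := h.symplectic.smooth _ Z (hA _ (hA Y hY)) hZ x
    refine ((h2.mul (h1.inv₀ hne)).congr_of_eventuallyEq ?_).mdifferentiableAt (by simp)
    filter_upwards [h1.continuousAt.eventually_ne hne] with y hy
    simp only [heq, Pi.mul_apply]
    rw [mul_assoc, mul_inv_cancel₀ hy, mul_one]
  obtain ⟨k, hk⟩ := exists_eq_const_of_mvfderiv_eq_zero hd fun x u => by
    obtain ⟨Y, Z, hY, hZ, hne⟩ := hloc x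
    obtain ⟨U, hU, rfl⟩ := exists_smoothV_apply_eq x u
    have h1 := h.connection.parallel.mvfderiv_eq h.symplectic.smooth (hA _ (hA Y hY)) hZ x (U x)
    rw [funext (heq Y Z), mvfderiv_fun_mul (hd x) (h.symplectic.smooth.mdifferentiableAt hY hZ x),
      hpA U _ hU (hA Y hY), hpA U Y hU hY, hc, hc] at h1
    simp only [add_apply, smul_apply, smul_eq_mul, map_smul, LinearMap.smul_apply,
      h.connection.parallel.mvfderiv_eq h.symplectic.smooth hY hZ] at h1
    have h2 : Ω x (Y x) (Z x) * mvfderiv 𝓘(ℝ, E) c x (U x) = 0 := by linarith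
    exact (mul_eq_zero.1 h2).resolve_left hne
  exact ⟨-k, fun x u => by rw [hc, hk, neg_neg]⟩

theorem ricciSq_eq_of_sq_eq (h : IsWeylFlatSymplectic n Ω cov) {r : ℝ} {x : M}
    (hr : ∀ u, ricciEnd Ω cov x (ricciEnd Ω cov x u) = -r • u) :
    ricciSq Ω cov x = 2 * n * r := by
  rw [← ricciSq_eq (h.isSymplecticDual x) h.card_eq (h.omega_ricciEnd x) (h.ricci_symm x) hr]
  refine Finset.sum_congr rfl fun p _ => Finset.sum_congr rfl fun q _ => ?_
  simp only [dualFrame, map_sum, map_smul, LinearMap.sum_apply, LinearMap.smul_apply, smul_eq_mul,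
    Finset.mul_sum]
  rw [Finset.sum_comm]
  exact Finset.sum_congr rfl fun _ _ => Finset.sum_congr rfl fun _ _ => by ring

theorem ricci_nondegenerate (h : IsWeylFlatSymplectic n Ω cov) {r : ℝ} (hr0 : r ≠ 0) {x : M}
    (hr : ∀ u, ricciEnd Ω cov x (ricciEnd Ω cov x u) = -r • u) {u : TangentSpace 𝓘(ℝ, E) x}
    (hu : ∀ v, ricci cov x u v = 0) : u = 0 := by
  have h1 : ricciEnd Ω cov x u = 0 :=
    (h.symplectic.nondegenerate x).1 _ fun v => by rw [h.omega_ricciEnd, hu]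
  have h2 := hr u
  rw [h1, map_zero, eq_comm, smul_eq_zero] at h2
  exact h2.resolve_left (neg_ne_zero.2 hr0)

theorem isPseudoRiemannianMetric_smul (h : IsWeylFlatSymplectic n Ω cov) {r k : ℝ} (hr0 : r ≠ 0)
    (hk : k ≠ 0) (hr : ∀ x u, ricciEnd Ω cov x (ricciEnd Ω cov x u) = -r • u) :
    IsPseudoRiemannianMetric (fun x => k • ricci cov x) where
  smooth := h.smoothForm_ricci.const_smul k
  symm x u v := by simp only [LinearMap.smul_apply, h.ricci_symm x u v]
  nondegenerate x := by
    refine ⟨fun u hu => h.ricci_nondegenerate hr0 (hr x) fun v => ?_,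
      fun u hu => h.ricci_nondegenerate hr0 (hr x) fun v => ?_⟩
    · have := hu v
      rw [LinearMap.smul_apply, LinearMap.smul_apply, smul_eq_zero] at this
      exact this.resolve_left hk
    · have := hu v
      rw [LinearMap.smul_apply, LinearMap.smul_apply, smul_eq_zero, h.ricci_symm] at this
      exact this.resolve_left hk

theorem isLeviCivita_smul (h : IsWeylFlatSymplectic n Ω cov) (hp : IsParallelForm cov (ricci cov))
    (k : ℝ) : IsLeviCivita (fun x => k • ricci cov x) cov where
  smooth := h.connection.smooth
  torsion_free := h.connection.torsion_free
  parallel := hp.const_smul h.smoothForm_ricci k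

/-- Weyl flatness alone: R = K(Ric)/(n+1), and Ric = g/k, so 2c = 1/((n+1)k). -/
theorem hasConstHolomorphicCurvature_smul (h : IsWeylFlatSymplectic n Ω cov) {k : ℝ} (hk : k ≠ 0) :
    HasConstHolomorphicCurvature (fun x => k • ricci cov x) Ω cov
      (1 / (2 * ((n : ℝ) + 1) * k)) := by
  intro x u v w z
  have hn : (n : ℝ) + 1 ≠ 0 := by positivity
  rw [h.omega_curv]
  simp only [modelForm, modelCurv, LinearMap.smul_apply, smul_eq_mul]
  field_simp

/-- The minus sign in the metric is forced by compatibility: Ric(Au,v) = Ω(A²u,v) = -r Ω(u,v) with r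
> 0. -/
theorem isPseudoKahler (h : IsWeylFlatSymplectic n Ω cov) (hp : IsParallelForm cov (ricci cov))
    {r : ℝ} (hr0 : 0 < r) (hr : ∀ x u, ricciEnd Ω cov x (ricciEnd Ω cov x u) = -r • u) :
    IsPseudoKahler (fun x => -(√|r|)⁻¹ • ricci cov x) (fun x => (√|r|)⁻¹ • ricciEnd Ω cov x) Ω := by
  have hA := h.smoothEnd_ricciEnd
  have hs : (√|r|)⁻¹ * (√|r|)⁻¹ * r = 1 := by
    rw [abs_of_pos hr0, ← mul_inv, Real.mul_self_sqrt hr0.le, inv_mul_cancel₀ hr0.ne']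
  have hs0 : (√|r|)⁻¹ ≠ 0 := fun h0 => by simp [h0] at hs
  exact
  { symplectic := h.symplectic
    complex :=
    { smooth := hA.const_smul _
      sq := fun x u => by
        rw [LinearMap.smul_apply, LinearMap.smul_apply, map_smul, hr, smul_smul, smul_smul,
          mul_neg, hs, neg_one_smul]
      integrable := ((h.isParallelEnd hp).const_smul hA _).isIntegrableEnd (hA.const_smul _)
        h.connection.torsion_free }
    metric := h.isPseudoRiemannianMetric_smul hr0.ne' (neg_ne_zero.2 hs0) hr
    compatible := fun x u v => by
      simp only [LinearMap.smul_apply, map_smul, smul_eq_mul]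
      rw [← h.omega_ricciEnd, hr, map_smul, LinearMap.smul_apply, smul_eq_mul]
      linear_combination Ω x u v * hs }

theorem isParaKahler (h : IsWeylFlatSymplectic n Ω cov) (hp : IsParallelForm cov (ricci cov))
    {r : ℝ} (hr0 : r < 0) (hr : ∀ x u, ricciEnd Ω cov x (ricciEnd Ω cov x u) = -r • u) :
    IsParaKahler (fun x => (√|r|)⁻¹ • ricci cov x) (fun x => (√|r|)⁻¹ • ricciEnd Ω cov x) Ω := by
  have hA := h.smoothEnd_ricciEnd
  have hs : (√|r|)⁻¹ * (√|r|)⁻¹ * -r = 1 := by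
    rw [abs_of_neg hr0, ← mul_inv, Real.mul_self_sqrt (by linarith),
      inv_mul_cancel₀ (neg_ne_zero.2 hr0.ne)]
  have hs0 : (√|r|)⁻¹ ≠ 0 := fun h0 => by simp [h0] at hs
  have hsq : ∀ (x : M) (u : TangentSpace 𝓘(ℝ, E) x), ((√|r|)⁻¹ • ricciEnd Ω cov x)
      (((√|r|)⁻¹ • ricciEnd Ω cov x) u) = u := fun x u => by
    rw [LinearMap.smul_apply, LinearMap.smul_apply, map_smul, hr, smul_smul, smul_smul, hs,
      one_smul]
  exact
  { symplectic := h.symplectic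
    paracomplex :=
    { smooth := hA.const_smul _
      sq := hsq
      eigenrank := fun x => have : FiniteDimensional ℝ (TangentSpace 𝓘(ℝ, E) x) :=
          inferInstanceAs (FiniteDimensional ℝ E)
        finrank_eigenspace_eq (h.symplectic.nondegenerate x) (fun u v => by
          simp only [LinearMap.smul_apply, map_smul]
          rw [h.omega_ricciEnd, h.omega_apply_ricciEnd, smul_neg, neg_neg]) (hsq x)
      integrable := ((h.isParallelEnd hp).const_smul hA _).isIntegrableEnd (hA.const_smul _)
        h.connection.torsion_free }
    metric := h.isPseudoRiemannianMetric_smul hr0.ne hs0 hr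
    compatible := fun x u v => by
      simp only [LinearMap.smul_apply, map_smul, smul_eq_mul]
      rw [← h.omega_ricciEnd, hr, map_smul, LinearMap.smul_apply, smul_eq_mul]
      linear_combination Ω x u v * hs }

/-! ### Two-step nilpotent Ricci endomorphisms -/

theorem ker_eq_annihilator (h : IsWeylFlatSymplectic n Ω cov) (x : M) :
    LinearMap.ker (ricciEnd Ω cov x)
      = annihilator Ω (fun y => LinearMap.range (ricciEnd Ω cov y)) x := by
  ext v
  rw [LinearMap.mem_ker, annihilator, LinearMap.BilinForm.mem_orthogonal_iff]
  constructor
  · rintro hv _ ⟨u, rfl⟩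
    rw [h.omega_ricciEnd, h.ricci_symm, ← h.omega_ricciEnd, hv,
      map_zero, LinearMap.zero_apply]
  · intro hv
    refine (h.symplectic.nondegenerate x).1 _ fun u => ?_
    rw [h.omega_ricciEnd, h.ricci_symm, ← h.omega_ricciEnd]
    exact hv _ ⟨u, rfl⟩

/-- Each term of `curv_eq` contains A applied to one of the arguments, since Ric(u,v) = Ω(Au,v). -/
theorem inducedFlat_ker (h : IsWeylFlatSymplectic n Ω cov) :
    InducedFlat cov (fun x => LinearMap.ker (ricciEnd Ω cov x)) := fun X Y Z hX hY hZ x => by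
  have h1 : ricciEnd Ω cov x (X x) = 0 := hX.2 x
  have h2 : ricciEnd Ω cov x (Y x) = 0 := hY.2 x
  have h3 : ricciEnd Ω cov x (Z x) = 0 := hZ.2 x
  rw [curvOp_eq_curv h.connection.smooth hX.1 hY.1 hZ.1, h.curv_eq, ← h.omega_ricciEnd,
    ← h.omega_ricciEnd, h1, h2, h3]
  simp

theorem inducedFlat_range (h : IsWeylFlatSymplectic n Ω cov)
    (hr : ∀ x u, ricciEnd Ω cov x (ricciEnd Ω cov x u) = 0) :
    InducedFlat cov (fun x => LinearMap.range (ricciEnd Ω cov x)) := fun X Y Z hX hY hZ => by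
  have h1 : ∀ {X : VField E M}, IsSection (fun x => LinearMap.range (ricciEnd Ω cov x)) X →
      IsSection (fun x => LinearMap.ker (ricciEnd Ω cov x)) X := fun hX => ⟨hX.1, fun x => by
    obtain ⟨w, hw⟩ := hX.2 x
    rw [LinearMap.mem_ker, ← hw, hr]⟩
  exact h.inducedFlat_ker X Y Z (h1 hX) (h1 hY) (h1 hZ)

theorem isFlat_of_ricciEnd_eq_zero (h : IsWeylFlatSymplectic n Ω cov)
    (h0 : ∀ x, ricciEnd Ω cov x = 0) : (∀ x, ricci cov x = 0) ∧ IsFlat cov := by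
  have h1 : ∀ x, ricci cov x = 0 := fun x => LinearMap.ext fun u => LinearMap.ext fun v => by
    rw [← h.omega_ricciEnd, h0]
    simp
  exact ⟨h1, fun x u v w => by simp [h.curv_eq, h0, h1]⟩

/-- The image has constant rank, so it is zero everywhere as soon as it is zero at one point. -/
theorem ricciEnd_eq_zero [ConnectedSpace M] (h : IsWeylFlatSymplectic n Ω cov)
    (hp : IsParallelForm cov (ricci cov)) {x : M} (hx : ricciEnd Ω cov x = 0) (y : M) :
    ricciEnd Ω cov y = 0 := by
  obtain ⟨k, hk⟩ :=
    (isSubbundle_of_parallelEnd h.connection.smooth h.smoothEnd_ricciEnd (h.isParallelEnd hp)).1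
  have h1 : ∀ z, Module.finrank ℝ (LinearMap.range (ricciEnd Ω cov z)) = k := fun z => by
    obtain ⟨s, -, hs⟩ := hk z
    have h2 := finrank_span_eq_card hs.self_of_nhds.1
    rwa [hs.self_of_nhds.2, Fintype.card_fin] at h2
  have h2 := h1 x
  rw [hx, LinearMap.range_zero, finrank_bot] at h2
  have h3 := h1 y
  rw [← h2] at h3
  have : FiniteDimensional ℝ (TangentSpace 𝓘(ℝ, E) y) := inferInstanceAs (FiniteDimensional ℝ E)
  exact LinearMap.range_eq_bot.1 (Submodule.finrank_eq_zero.1 h3)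

theorem isFlatTotallyGeodesicSubbundle [ConnectedSpace M] (h : IsWeylFlatSymplectic n Ω cov)
    (hp : IsParallelForm cov (ricci cov))
    (hr : ∀ x u, ricciEnd Ω cov x (ricciEnd Ω cov x u) = 0) :
    IsFlatTotallyGeodesicSubbundle cov (fun x => LinearMap.range (ricciEnd Ω cov x)) ∧
      IsFlatTotallyGeodesicSubbundle cov (fun x => LinearMap.ker (ricciEnd Ω cov x)) := by
  have hA := h.smoothEnd_ricciEnd
  have hpA := h.isParallelEnd hp
  have hcov := h.connection.smooth
  have hs := isSubbundle_of_parallelEnd hcov hA hpA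
  have hg := hpA.isTotallyGeodesic_range hcov hA
  exact ⟨⟨hs.1, hg, hg.isIntegrable h.connection.torsion_free, h.inducedFlat_range hr⟩,
    ⟨hs.2, hpA.isTotallyGeodesic_ker,
      hpA.isTotallyGeodesic_ker.isIntegrable h.connection.torsion_free, h.inducedFlat_ker⟩⟩

end IsWeylFlatSymplectic

end RicciParallel

end SymplecticConnection

end

theorem mainTheorem4 (n : ℕ) (hn : 1 ≤ n)
    {M : Type*} [TopologicalSpace M] [T2Space M] [SecondCountableTopology M] [ConnectedSpace M]
    [ChartedSpace (EuclideanSpace ℝ (Fin (2 * n))) M]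
    [IsManifold 𝓘(ℝ, EuclideanSpace ℝ (Fin (2 * n))) ∞ M]
    (Ω : SymplecticConnection.FormField (EuclideanSpace ℝ (Fin (2 * n))) M)
    (hΩ : SymplecticConnection.IsSymplecticForm Ω)
    (cov : SymplecticConnection.Conn (EuclideanSpace ℝ (Fin (2 * n))) M)
    (hcov : SymplecticConnection.IsSymplecticConnection Ω cov)
    (hflat : SymplecticConnection.IsSymplecticallyFlat n Ω cov) :
    List.TFAE [
      ∀ x u, SymplecticConnection.curvatureOneForm Ω cov x u = 0,
      SymplecticConnection.IsParallelForm cov (SymplecticConnection.ricci cov),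
      SymplecticConnection.IsLocallySymmetric cov] ∧
    ((∀ x u, SymplecticConnection.curvatureOneForm Ω cov x u = 0) →
      ∃ r : ℝ,
        (∀ x, SymplecticConnection.ricciSq Ω cov x = 2 * n * r) ∧
        (∀ x u, SymplecticConnection.ricciEnd Ω cov x
          (SymplecticConnection.ricciEnd Ω cov x u) = -r • u) ∧
        (0 < r →
          SymplecticConnection.IsPseudoKahler
            (fun x => -(√|r|)⁻¹ • SymplecticConnection.ricci cov x)
            (fun x => (√|r|)⁻¹ • SymplecticConnection.ricciEnd Ω cov x) Ω ∧
          SymplecticConnection.IsLeviCivita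
            (fun x => -(√|r|)⁻¹ • SymplecticConnection.ricci cov x) cov ∧
          ∃ c : ℝ, SymplecticConnection.HasConstHolomorphicCurvature
            (fun x => -(√|r|)⁻¹ • SymplecticConnection.ricci cov x) Ω cov c) ∧
        (r < 0 →
          SymplecticConnection.IsParaKahler
            (fun x => (√|r|)⁻¹ • SymplecticConnection.ricci cov x)
            (fun x => (√|r|)⁻¹ • SymplecticConnection.ricciEnd Ω cov x) Ω ∧
          SymplecticConnection.IsLeviCivita
            (fun x => (√|r|)⁻¹ • SymplecticConnection.ricci cov x) cov ∧
          ∃ c : ℝ, SymplecticConnection.HasConstHolomorphicCurvature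
            (fun x => (√|r|)⁻¹ • SymplecticConnection.ricci cov x) Ω cov c) ∧
        (r = 0 →
          ((∀ x, SymplecticConnection.ricci cov x = 0) ∧ SymplecticConnection.IsFlat cov) ∨
          (SymplecticConnection.IsParallelEnd cov (SymplecticConnection.ricciEnd Ω cov) ∧
            SymplecticConnection.IsInfSymplectic Ω (SymplecticConnection.ricciEnd Ω cov) ∧
            SymplecticConnection.IsTwoStepNilpotent (SymplecticConnection.ricciEnd Ω cov) ∧
            (∀ x, (SymplecticConnection.ricciEnd Ω cov x).ker =
              SymplecticConnection.annihilator Ω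
                (fun y => (SymplecticConnection.ricciEnd Ω cov y).range) x) ∧
            SymplecticConnection.IsFlatTotallyGeodesicSubbundle cov
              (fun x => (SymplecticConnection.ricciEnd Ω cov x).range) ∧
            SymplecticConnection.IsFlatTotallyGeodesicSubbundle cov
              (fun x => (SymplecticConnection.ricciEnd Ω cov x).ker)))) := by
  have h : SymplecticConnection.IsWeylFlatSymplectic n Ω cov :=
    ⟨hn, finrank_euclideanSpace_fin, hΩ, hcov, hflat.1⟩
  refine ⟨h.tfae hflat.2, fun hρ => ?_⟩
  have hp := h.parallel_of_curvatureOneForm hflat.2 hρ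
  obtain ⟨r, hr⟩ := h.exists_sq_eq hp
  refine ⟨r, fun x => h.ricciSq_eq_of_sq_eq (hr x), hr, fun hr0 => ?_, fun hr0 => ?_, fun hr0 => ?_⟩
  · have hk : -(√|r|)⁻¹ ≠ 0 :=
      neg_ne_zero.2 (inv_ne_zero (Real.sqrt_ne_zero'.2 (abs_pos.2 hr0.ne')))
    exact ⟨h.isPseudoKahler hp hr0 hr, h.isLeviCivita_smul hp _,
      _, h.hasConstHolomorphicCurvature_smul hk⟩
  · have hk : (√|r|)⁻¹ ≠ 0 :=
      inv_ne_zero (Real.sqrt_ne_zero'.2 (abs_pos.2 hr0.ne))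
    exact ⟨h.isParaKahler hp hr0 hr, h.isLeviCivita_smul hp _,
      _, h.hasConstHolomorphicCurvature_smul hk⟩
  · have hr' : ∀ x u, SymplecticConnection.ricciEnd Ω cov x
        (SymplecticConnection.ricciEnd Ω cov x u) = 0 := fun x u => by
      rw [hr, hr0, neg_zero, zero_smul]
    -- A single zero of the Ricci endomorphism already forces the flat case; otherwise it is nonzero
    -- at every point, as two-step nilpotency requires.
    by_cases hx : ∃ x, SymplecticConnection.ricciEnd Ω cov x = 0
    · obtain ⟨x, hx⟩ := hx
      exact Or.inl (h.isFlat_of_ricciEnd_eq_zero (h.ricciEnd_eq_zero hp hx))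
    · push Not at hx
      exact Or.inr ⟨h.isParallelEnd hp, h.isInfSymplectic,
        fun x => ⟨LinearMap.ext (hr' x), hx x⟩, h.ker_eq_annihilator,
        h.isFlatTotallyGeodesicSubbundle hp hr'⟩
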